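/- **Theorem 4.1 (Borovkov–Pfeifer approximation).** Let $I_i$, $i\ge 1$, be Bernoulli random variables on a probability space, with an arbitrary joint law, and put $p_i=\mathbb P(I_i=1)$. Fix $n$ and let $$W=\sum_{i=1}^n I_i,\qquad W^{(i)}=W-I_i,\qquad \lambda=\sum_{i=1}^n p_i>0 .$$ For $1\le i\le n$ with $p_i>0$ let $\widetilde W^{(i)}$ be a random variable on the same space whose law is the conditional law of $W^{(i)}$ given $I_i=1$; let $$\eta_1=\sum_{i=1}^n \frac{p_i}{1-2p_i}\,\mathbb E\bigl|\widetilde W^{(i)}-W^{(i)}\bigr| ,$$ where terms with $p_i=0$ are zero. Assume that $p_i<1/3$ for all $i\ge1$, that $\sum_{i\ge1}p_i^2<\infty$, and that $$\theta_1=\frac1\lambda\sum_{i=1}^\infty \frac{p_i^2}{(1-2p_i)^2}<\frac12 .$$ Let $\mathrm{BP}$ be the signed measure on $\mathbb Z_+=\{0,1,2,\dots\}$ with generating function $$\widehat{\mathrm{BP}}(z)=\sum_{k\ge0}\mathrm{BP}\{k\}z^k=\prod_{i=1}^\infty\Bigl\{\bigl(1+p_i(z-1)\bigr)e^{-p_i(z-1)}\Bigr\},\qquad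 |z|\le1 ;$$ that is, $\mathrm{BP}\{k\}$ is the coefficient of $z^k$ in the power series of the product at $0$. Then $\mathrm{BP}$ is well defined: the product converges for $|z|\le 1$, $\sum_k|\mathrm{BP}\{k\}|<\infty$, and the displayed identity holds for $|z|\le1$. The convolution $\mathrm{Po}(\lambda)*\mathrm{BP}$ is a finite signed compound Poisson measure (its generating function is $\exp\{\sum_{l\ge1}\rho_l(z^l-1)\}$ for $|z|\le 1$, with real $\rho_l$, $\sum_l|\rho_l|<\infty$), and $\sum_k k\,|\mathrm{Po}(\lambda)*\mathrm{BP}|\{k\}<\infty$. For finite signed measures $P,Q$ on $\mathbb Z_+$ with finite first absolute moments, and with $P(f)=\sum_k P\{k\}f(k)$, let $d_{TV}(P,Q)=\sup\{|P(f)-Q(f)|: |f|\le 1\}$, $d_W(P,Q)=\sup\{|P(f)-Q(f)|: |f(k+1)-f(k)|\le 1\ \forall k\}$ and $d_{\rm pt}(P,Q)=\sup_k|P\{k\}-Q\{k\}|$. Then $$d_{TV}(\mathcal L(W),\mathrm{Po}(\lambda)*\mathrm{BP})\le\frac{2}{\lambda(1-2\theta_1)}\Bigl(\sum_{i=n+1}^\infty\frac{p_i^2}{(1-2p_i)^2}+\eta_1\Bigr),$$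 $$d_{\rm pt}(\mathcal L(W),\mathrm{Po}(\lambda)*\mathrm{BP})\le\frac{2}{\lambda(1-2\theta_1)}\Bigl(\sup_k\mathbb P(W=k)\sum_{i=n+1}^\infty\frac{p_i^2}{(1-2p_i)^2}+\eta_1\Bigr),$$ $$d_W(\mathcal L(W),\mathrm{Po}(\lambda)*\mathrm{BP})\le\frac{1.15}{\sqrt\lambda\,(1-2\theta_1)}\Bigl(\sum_{i=n+1}^\infty\frac{p_i^2}{(1-2p_i)^2}+\eta_1\Bigr).$$ -/

import Mathlib

open scoped ENNReal
open MeasureTheory ProbabilityTheory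

namespace BorovkovPfeifer

noncomputable section

/-! Finite signed measures on the non-negative integers are represented by their masses
`a : ℕ → ℝ` with `∑ |a k| < ∞`.  The Bernoulli variables and their success probabilities are
enumerated from `0`, so that the first `n` of them have the indices `0, …, n - 1`. -/

/-- The `i`-th factor `(1 + pᵢ (z - 1)) exp (- pᵢ (z - 1))` of the generating function. -/
def bpFactor (p : ℕ → ℝ) (z : ℂ) (i : ℕ) : ℂ :=
  (1 + (p i : ℂ) * (z - 1)) * Complex.exp (-((p i : ℂ) * (z - 1)))

/-- The generating function of the signed measure `BP`, an infinite product. -/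
def bpGenFun (p : ℕ → ℝ) (z : ℂ) : ℂ :=
  ∏' i, bpFactor p z i

/-- The mass at `k` of the signed measure `BP`: the coefficient of `z ^ k` in the power series
of its generating function. -/
def bp (p : ℕ → ℝ) (k : ℕ) : ℝ :=
  (iteratedDeriv k (bpGenFun p) 0 / (k.factorial : ℂ)).re

/-- Convolution of signed measures on the non-negative integers. -/
def conv (a b : ℕ → ℝ) (k : ℕ) : ℝ :=
  ∑ j ∈ Finset.range (k + 1), a j * b (k - j)

/-- The masses of the Poisson distribution with mean `l ≥ 0`. -/
def poissonMass (l : ℝ) (k : ℕ) : ℝ :=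
  (poissonMeasure l.toNNReal).real {k}

/-- `λ`, the sum of the first `n` success probabilities. -/
def lam (p : ℕ → ℝ) (n : ℕ) : ℝ :=
  ∑ i ∈ Finset.range n, p i

/-- The approximation `Po(λ) * BP`. -/
def bpApprox (p : ℕ → ℝ) (n : ℕ) : ℕ → ℝ :=
  conv (poissonMass (lam p n)) (bp p)

/-- `θ₁`; the sum in the numerator is over all indices. -/
def theta (p : ℕ → ℝ) (n : ℕ) : ℝ :=
  (∑' i, p i ^ 2 / (1 - 2 * p i) ^ 2) / lam p n

/-- The sum of `pᵢ² / (1 - 2 pᵢ)²` over all indices beyond the first `n`. -/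
def tailSum (p : ℕ → ℝ) (n : ℕ) : ℝ :=
  ∑' i, p (n + i) ^ 2 / (1 - 2 * p (n + i)) ^ 2

/-- `W`, the sum of the first `n` variables. -/
def W {Ω : Type*} (I : ℕ → Ω → ℕ) (n : ℕ) (ω : Ω) : ℕ :=
  ∑ j ∈ Finset.range n, I j ω

/-- `W - Iᵢ` (for `i < n`). -/
def Wminus {Ω : Type*} (I : ℕ → Ω → ℕ) (n i : ℕ) (ω : Ω) : ℕ :=
  ∑ j ∈ (Finset.range n).erase i, I j ω

/-- `η₁`, which depends on the chosen variables `Wt i`. -/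
def eta {Ω : Type*} [MeasurableSpace Ω] (μ : Measure Ω) (p : ℕ → ℝ) (I Wt : ℕ → Ω → ℕ)
    (n : ℕ) : ℝ :=
  ∑ i ∈ Finset.range n,
    p i / (1 - 2 * p i) * ∫ ω, |(Wt i ω : ℝ) - (Wminus I n i ω : ℝ)| ∂μ

/-- The masses of the law of an integer-valued random variable. -/
def lawMass {Ω : Type*} [MeasurableSpace Ω] (μ : Measure Ω) (X : Ω → ℕ) (k : ℕ) : ℝ :=
  μ.real {ω | X ω = k}

/-- The distance `sup_{f ∈ H} |P(f) - Q(f)|`, where `P(f) = ∑ P{k} f(k)`. -/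
def distH (H : Set (ℕ → ℝ)) (P Q : ℕ → ℝ) : ℝ≥0∞ :=
  ⨆ f ∈ H, ENNReal.ofReal |∑' k, P k * f k - ∑' k, Q k * f k|

/-- Total variation distance: the test functions are those bounded by `1`. -/
def distTV (P Q : ℕ → ℝ) : ℝ≥0∞ :=
  distH {f | ∀ k, |f k| ≤ 1} P Q

/-- Wasserstein distance: the test functions are those with `|f(k+1) - f(k)| ≤ 1`. -/
def distW (P Q : ℕ → ℝ) : ℝ≥0∞ :=
  distH {f | ∀ k, |f (k + 1) - f k| ≤ 1} P Q

/-- Point metric. -/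
def distPt (P Q : ℕ → ℝ) : ℝ≥0∞ :=
  ⨆ k, ENNReal.ofReal |P k - Q k|

/-- A signed compound Poisson measure on the non-negative integers: its generating function is
`exp (∑_{l ≥ 1} ρ l (z ^ l - 1))` with real `ρ l`, absolutely summable. -/
def IsSignedCompoundPoisson (a : ℕ → ℝ) : Prop :=
  Summable (fun k => |a k|) ∧
    ∃ ρ : ℕ → ℝ, Summable (fun l => |ρ l|) ∧
      ∀ z : ℂ, ‖z‖ ≤ 1 →
        HasSum (fun k => (a k : ℂ) * z ^ k)
          (Complex.exp (∑' l, (ρ (l + 1) : ℂ) * (z ^ (l + 1) - 1)))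

end

end BorovkovPfeifer

/-! Write `q_i = p_i / (1 - p_i)`, which is below 1/2. The logarithmic derivative of the factor of
index `i` is `q_i / (1 + q_i z) - p_i`. Its coefficients are bounded by `p_i ^ 2` times a fixed
geometric sequence, so BP is the exponential of an absolutely convergent series. For `Q = Po(λ) *
BP` the equation `G' = A G` between generating functions, read coefficientwise and tested against
`u`, is a Stein identity: `Q(k u(k-1)) = Q(λ u + R u)`, where `R u (j) = ∑ (g_i(j) - p_i u(j))` and
`g_i(j) = ∑ q_i (-q_i)^m u(j+m)` (`stein_identity`). Thus `Q` solves a perturbed Poisson equation.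

One relation is used twice: `(1 - p_i) g_i(j) + p_i g_i(j+1) = p_i u(j)` (`geomSum_add`). It gives
`g_i - p_i u = -p_i Δg_i`, so that `|R u| ≤ λ θ sup |Δu|`. It also handles `W`: together with `E[I_i
u(W^(i))] = p_i E u(W~^(i))` it turns `E g_i(W) - E[I_i u(W^(i))]` into `E g_i(W^(i)) - E
g_i(W~^(i))`, which is controlled by `E|W~^(i) - W^(i)|` (`abs_stein_step_le`). The first `n`
indices produce `eta`, the others the tail sum.

Only the Poisson equation `λ u(j) - j u(j-1) = f(j) - Po(λ)(f)` has to be solved. Then `P(f) -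
Q(f)`, with `P` the law of `W`, is at most the eta and tail terms plus `|(P - Q)(R u)|`
(`abs_tsum_diff_le`). For total variation `sup |Δu| ≤ 2/λ`, so the last term is at most `2θ` times
the distance itself and is absorbed because `2θ < 1`. The point metric works alike, with `∑ |Δu| ≤
2/λ` paired with sup norms. For the Wasserstein distance `sup |Δu| ≤ 1.15/√λ`, obtained by
interpolating between a point mass and the Poisson law, and the last term is bounded by the total
variation estimate. -/

namespace BorovkovPfeifer

/-! ### Power series with absolutely summable coefficients and their exponentials -/

/-- Absolute summability of the coefficients of a power series. -/
def AbsSummable (A : PowerSeries ℝ) : Prop :=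
  Summable fun k => |PowerSeries.coeff k A|

/-- The value at `z` of a power series with real coefficients. -/
noncomputable def seriesVal (A : PowerSeries ℝ) (z : ℂ) : ℂ :=
  ∑' k, ((PowerSeries.coeff k A : ℝ) : ℂ) * z ^ k

theorem AbsSummable.norm_term {A : PowerSeries ℝ} (hA : AbsSummable A) {z : ℂ} (hz : ‖z‖ ≤ 1) :
    Summable fun k => ‖((PowerSeries.coeff k A : ℝ) : ℂ) * z ^ k‖ := by
  refine Summable.of_nonneg_of_le (fun _ => norm_nonneg _) (fun k => ?_) hA
  rw [norm_mul, norm_pow, Complex.norm_real, Real.norm_eq_abs]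
  exact mul_le_of_le_one_right (abs_nonneg _) (pow_le_one₀ (norm_nonneg _) hz)

theorem AbsSummable.hasSum {A : PowerSeries ℝ} (hA : AbsSummable A) {z : ℂ} (hz : ‖z‖ ≤ 1) :
    HasSum (fun k => ((PowerSeries.coeff k A : ℝ) : ℂ) * z ^ k) (seriesVal A z) :=
  (hA.norm_term hz).of_norm.hasSum

theorem abs_coeff_mul_le (A B : PowerSeries ℝ) (k : ℕ) :
    |PowerSeries.coeff k (A * B)| ≤ ∑ x ∈ Finset.HasAntidiagonal.antidiagonal k,
      |PowerSeries.coeff x.1 A| * |PowerSeries.coeff x.2 B| := by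
  rw [PowerSeries.coeff_mul]
  refine (Finset.abs_sum_le_sum_abs _ _).trans_eq ?_
  simp only [abs_mul]

theorem summable_mul_prod {u v : ℕ → ℝ} (hu : Summable u) (hv : Summable v) :
    Summable fun x : ℕ × ℕ => u x.1 * v x.2 :=
  summable_mul_of_summable_norm hu.norm hv.norm

theorem AbsSummable.summable_antidiagonal {A B : PowerSeries ℝ} (hA : AbsSummable A)
    (hB : AbsSummable B) :
    Summable fun k => ∑ x ∈ Finset.HasAntidiagonal.antidiagonal k,
      |PowerSeries.coeff x.1 A| * |PowerSeries.coeff x.2 B| :=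
  summable_sum_mul_antidiagonal_of_summable_mul (f := fun k => |PowerSeries.coeff k A|)
    (g := fun k => |PowerSeries.coeff k B|)
    (summable_mul_prod (u := fun k => |PowerSeries.coeff k A|)
      (v := fun k => |PowerSeries.coeff k B|) hA hB)

theorem AbsSummable.mul {A B : PowerSeries ℝ} (hA : AbsSummable A) (hB : AbsSummable B) :
    AbsSummable (A * B) :=
  Summable.of_nonneg_of_le (fun _ => abs_nonneg _) (abs_coeff_mul_le A B)
    (hA.summable_antidiagonal hB)

theorem AbsSummable.tsum_mul_le {A B : PowerSeries ℝ} (hA : AbsSummable A) (hB : AbsSummable B) :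
    ∑' k, |PowerSeries.coeff k (A * B)| ≤
      (∑' k, |PowerSeries.coeff k A|) * ∑' k, |PowerSeries.coeff k B| := by
  have h := Summable.tsum_mul_tsum_eq_tsum_sum_antidiagonal
    (f := fun k => |PowerSeries.coeff k A|) (g := fun k => |PowerSeries.coeff k B|) hA hB
    (summable_mul_prod (u := fun k => |PowerSeries.coeff k A|)
      (v := fun k => |PowerSeries.coeff k B|) hA hB)
  rw [h]
  exact Summable.tsum_le_tsum (abs_coeff_mul_le A B) (hA.mul hB) (hA.summable_antidiagonal hB)

theorem AbsSummable.seriesVal_mul {A B : PowerSeries ℝ} (hA : AbsSummable A)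
    (hB : AbsSummable B) {z : ℂ} (hz : ‖z‖ ≤ 1) :
    seriesVal (A * B) z = seriesVal A z * seriesVal B z := by
  unfold seriesVal
  rw [tsum_mul_tsum_eq_tsum_sum_antidiagonal_of_summable_norm
    (f := fun k => ((PowerSeries.coeff k A : ℝ) : ℂ) * z ^ k)
    (g := fun k => ((PowerSeries.coeff k B : ℝ) : ℂ) * z ^ k) (hA.norm_term hz) (hB.norm_term hz)]
  refine tsum_congr fun k => ?_
  rw [PowerSeries.coeff_mul, Complex.ofReal_sum, Finset.sum_mul]
  refine Finset.sum_congr rfl fun x hx => ?_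
  rw [← Finset.HasAntidiagonal.mem_antidiagonal.mp hx, pow_add]
  push_cast
  ring

theorem absSummable_one : AbsSummable 1 := by
  refine summable_of_ne_finset_zero (s := {0}) fun k hk => ?_
  simp only [Finset.mem_singleton] at hk
  simp [PowerSeries.coeff_one, hk]

theorem AbsSummable.pow {A : PowerSeries ℝ} (hA : AbsSummable A) (m : ℕ) :
    AbsSummable (A ^ m) ∧
      ∑' k, |PowerSeries.coeff k (A ^ m)| ≤ (∑' k, |PowerSeries.coeff k A|) ^ m ∧
      ∀ z : ℂ, ‖z‖ ≤ 1 → seriesVal (A ^ m) z = seriesVal A z ^ m := by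
  induction m with
  | zero =>
    refine ⟨by simpa using absSummable_one, ?_, fun z _ => ?_⟩
    · rw [pow_zero, pow_zero, tsum_eq_single (0 : ℕ)]
      · simp
      · intro k hk
        simp [PowerSeries.coeff_one, hk]
    · unfold seriesVal
      rw [pow_zero, pow_zero, tsum_eq_single (0 : ℕ)]
      · simp
      · intro k hk
        simp [PowerSeries.coeff_one, hk]
  | succ m ih =>
    obtain ⟨h1, h2, h3⟩ := ih
    refine ⟨by rw [pow_succ]; exact h1.mul hA, ?_, fun z hz => ?_⟩
    · rw [pow_succ, pow_succ]
      exact (h1.tsum_mul_le hA).trans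
        (mul_le_mul_of_nonneg_right h2 (tsum_nonneg fun _ => abs_nonneg _))
    · rw [pow_succ, pow_succ, h1.seriesVal_mul hA hz, h3 z hz]

/-- The exponential of a power series with absolutely summable coefficients. -/
noncomputable def expSeries (A : PowerSeries ℝ) : PowerSeries ℝ :=
  PowerSeries.mk fun k => ∑' m : ℕ, PowerSeries.coeff k (A ^ m) / (m.factorial : ℝ)

/-- The `ℓ¹` norm is submultiplicative, so the double series is dominated by `∑ ‖A‖ ^ m / m!`. This
licenses every interchange of sums below. -/
theorem AbsSummable.summable_exp_terms {A : PowerSeries ℝ} (hA : AbsSummable A) :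
    Summable fun x : ℕ × ℕ =>
      |PowerSeries.coeff x.2 (A ^ x.1) / (x.1.factorial : ℝ)| := by
  rw [summable_prod_of_nonneg fun _ => abs_nonneg _]
  have key : ∀ m k : ℕ, |PowerSeries.coeff k (A ^ m) / (m.factorial : ℝ)| =
      |PowerSeries.coeff k (A ^ m)| * (m.factorial : ℝ)⁻¹ := fun m k => by
    rw [abs_div, Nat.abs_cast, div_eq_mul_inv]
  simp only [key]
  refine ⟨fun m => (hA.pow m).1.mul_right _, ?_⟩
  simp only [tsum_mul_right]
  refine Summable.of_nonneg_of_le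
    (fun m => mul_nonneg (tsum_nonneg fun _ => abs_nonneg _) (by positivity)) (fun m => ?_)
    (Real.summable_pow_div_factorial (∑' k, |PowerSeries.coeff k A|))
  rw [div_eq_mul_inv]
  exact mul_le_mul_of_nonneg_right (hA.pow m).2.1 (by positivity)

theorem AbsSummable.summable_coeff_exp {A : PowerSeries ℝ} (hA : AbsSummable A) (k : ℕ) :
    Summable fun m : ℕ => PowerSeries.coeff k (A ^ m) / (m.factorial : ℝ) := by
  have h := hA.summable_exp_terms.prod_symm.prod_factor k
  exact h.of_abs

theorem AbsSummable.expSeries {A : PowerSeries ℝ} (hA : AbsSummable A) :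
    AbsSummable (expSeries A) := by
  have h : Summable fun x : ℕ × ℕ =>
      |PowerSeries.coeff x.1 (A ^ x.2) / (x.2.factorial : ℝ)| := hA.summable_exp_terms.prod_symm
  have h' : Summable fun k => ∑' m : ℕ, |PowerSeries.coeff k (A ^ m) / (m.factorial : ℝ)| :=
    h.prod
  refine Summable.of_nonneg_of_le (fun _ => abs_nonneg _) (fun k => ?_) h'
  rw [BorovkovPfeifer.expSeries, PowerSeries.coeff_mk]
  exact norm_tsum_le_tsum_norm (f := fun m : ℕ =>
    PowerSeries.coeff k (A ^ m) / (m.factorial : ℝ)) (h.prod_factor k)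

theorem AbsSummable.seriesVal_expSeries {A : PowerSeries ℝ} (hA : AbsSummable A) {z : ℂ}
    (hz : ‖z‖ ≤ 1) :
    seriesVal (BorovkovPfeifer.expSeries A) z = Complex.exp (seriesVal A z) := by
  have hs : Summable fun x : ℕ × ℕ =>
      ((PowerSeries.coeff x.2 (A ^ x.1) / (x.1.factorial : ℝ) : ℝ) : ℂ) * z ^ x.2 := by
    refine Summable.of_norm (Summable.of_nonneg_of_le (fun _ => norm_nonneg _) (fun x => ?_)
      hA.summable_exp_terms)
    rw [norm_mul, norm_pow, Complex.norm_real, Real.norm_eq_abs]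
    exact mul_le_of_le_one_right (abs_nonneg _) (pow_le_one₀ (norm_nonneg _) hz)
  have h1 := Summable.tsum_comm (f := fun m k : ℕ =>
    ((PowerSeries.coeff k (A ^ m) / (m.factorial : ℝ) : ℝ) : ℂ) * z ^ k) hs
  have h2 : ∀ k : ℕ, ∑' m : ℕ,
      ((PowerSeries.coeff k (A ^ m) / (m.factorial : ℝ) : ℝ) : ℂ) * z ^ k =
      ((PowerSeries.coeff k (BorovkovPfeifer.expSeries A) : ℝ) : ℂ) * z ^ k := by
    intro k
    rw [tsum_mul_right, BorovkovPfeifer.expSeries, PowerSeries.coeff_mk, Complex.ofReal_tsum]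
  have h3 : ∀ m : ℕ, ∑' k : ℕ,
      ((PowerSeries.coeff k (A ^ m) / (m.factorial : ℝ) : ℝ) : ℂ) * z ^ k =
      seriesVal A z ^ m / (m.factorial : ℂ) := by
    intro m
    rw [← (hA.pow m).2.2 z hz, seriesVal, ← tsum_div_const]
    refine tsum_congr fun k => ?_
    push_cast
    ring
  rw [seriesVal, ← tsum_congr h2, h1, tsum_congr h3, Complex.exp_eq_exp_ℂ,
    NormedSpace.exp_eq_tsum_div]

/-- This is `(exp A)' = A' exp A`, obtained term by term from the derivative of `A ^ (m + 1)`. It is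
the source of the Stein identity. -/
theorem AbsSummable.coeff_succ_expSeries {A : PowerSeries ℝ} (hA : AbsSummable A) (k : ℕ) :
    ((k : ℝ) + 1) * PowerSeries.coeff (k + 1) (BorovkovPfeifer.expSeries A) =
      ∑ x ∈ Finset.HasAntidiagonal.antidiagonal k, (((x.1 : ℝ) + 1) * PowerSeries.coeff (x.1 + 1) A) *
        PowerSeries.coeff x.2 (BorovkovPfeifer.expSeries A) := by
  have h0 : PowerSeries.coeff (k + 1) (A ^ 0) / ((Nat.factorial 0 : ℕ) : ℝ) = 0 := by
    simp [PowerSeries.coeff_one]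
  have key : ∀ m : ℕ, ((k : ℝ) + 1) *
      (PowerSeries.coeff (k + 1) (A ^ (m + 1)) / ((m + 1).factorial : ℝ)) =
      ∑ x ∈ Finset.HasAntidiagonal.antidiagonal k, (((x.1 : ℝ) + 1) * PowerSeries.coeff (x.1 + 1) A) *
        (PowerSeries.coeff x.2 (A ^ m) / (m.factorial : ℝ)) := by
    intro m
    have hd : PowerSeries.coeff k (PowerSeries.derivative ℝ (A ^ (m + 1))) =
        PowerSeries.coeff k (((m : ℝ) + 1) • (PowerSeries.derivative ℝ A * A ^ m)) := by
      rw [Derivation.leibniz_pow, Nat.add_sub_cancel, ← Nat.cast_smul_eq_nsmul ℝ, smul_eq_mul,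
        mul_comm (A ^ m)]
      push_cast
      rfl
    rw [PowerSeries.coeff_derivative, PowerSeries.coeff_smul, PowerSeries.coeff_mul,
      smul_eq_mul] at hd
    have hm : ((m + 1).factorial : ℝ) = ((m : ℝ) + 1) * (m.factorial : ℝ) := by
      rw [Nat.factorial_succ]; push_cast; ring
    have hm0 : (m.factorial : ℝ) ≠ 0 := by positivity
    have hm1 : (m : ℝ) + 1 ≠ 0 := by positivity
    rw [hm, mul_div_assoc', mul_comm ((k : ℝ) + 1), hd, mul_div_mul_left _ _ hm1, Finset.sum_div]
    refine Finset.sum_congr rfl fun x _ => ?_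
    rw [PowerSeries.coeff_derivative]
    ring
  rw [BorovkovPfeifer.expSeries, PowerSeries.coeff_mk,
    (hA.summable_coeff_exp (k + 1)).tsum_eq_zero_add, h0, zero_add, ← tsum_mul_left,
    tsum_congr key, Summable.tsum_finsetSum]
  · refine Finset.sum_congr rfl fun x _ => ?_
    rw [tsum_mul_left, PowerSeries.coeff_mk]
  · intro x _
    exact (hA.summable_coeff_exp x.2).mul_left _

/-- By the previous recursion the derivative of `exp A` is a product of two absolutely summable
series. It supplies the finite first moment. -/
theorem AbsSummable.summable_mul_coeff_expSeries {A : PowerSeries ℝ} (hA : AbsSummable A)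
    (hA' : Summable fun k : ℕ => ((k : ℝ) + 1) * |PowerSeries.coeff (k + 1) A|) :
    Summable fun k : ℕ => (k : ℝ) * |PowerSeries.coeff k (BorovkovPfeifer.expSeries A)| := by
  rw [← summable_nat_add_iff 1]
  have h := summable_sum_mul_antidiagonal_of_summable_mul
    (f := fun k : ℕ => ((k : ℝ) + 1) * |PowerSeries.coeff (k + 1) A|)
    (g := fun k => |PowerSeries.coeff k (BorovkovPfeifer.expSeries A)|)
    (summable_mul_prod (u := fun k : ℕ => ((k : ℝ) + 1) * |PowerSeries.coeff (k + 1) A|)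
      (v := fun k => |PowerSeries.coeff k (BorovkovPfeifer.expSeries A)|) hA' hA.expSeries)
  refine Summable.of_nonneg_of_le (fun _ => by positivity) (fun k => ?_) h
  have h1 : ((k + 1 : ℕ) : ℝ) * |PowerSeries.coeff (k + 1) (BorovkovPfeifer.expSeries A)| =
      |((k : ℝ) + 1) * PowerSeries.coeff (k + 1) (BorovkovPfeifer.expSeries A)| := by
    rw [abs_mul, abs_of_nonneg (by positivity : (0 : ℝ) ≤ (k : ℝ) + 1)]
    push_cast
    rfl
  rw [h1, hA.coeff_succ_expSeries]
  refine (Finset.abs_sum_le_sum_abs _ _).trans_eq (Finset.sum_congr rfl fun x _ => ?_)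
  rw [abs_mul, abs_mul, abs_of_nonneg (by positivity : (0 : ℝ) ≤ (x.1 : ℝ) + 1)]

/-- Coefficients are recovered from the values on the closed unit disc. -/
theorem iteratedDeriv_div_factorial_of_hasSum {a : ℕ → ℝ} {F : ℂ → ℂ}
    (hF : ∀ z : ℂ, ‖z‖ ≤ 1 → HasSum (fun k => (a k : ℂ) * z ^ k) (F z)) (k : ℕ) :
    (iteratedDeriv k F 0 / (k.factorial : ℂ)).re = a k := by
  have hps : HasFPowerSeriesOnBall F
      (FormalMultilinearSeries.ofScalars ℂ (fun k => (a k : ℂ))) 0 1 := by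
    refine ⟨?_, one_pos, ?_⟩
    -- Absolute convergence at `z = 1` makes the radius of convergence at least 1.
    · refine FormalMultilinearSeries.le_radius_of_summable_norm _ (r := 1) ?_
      have h := (hF 1 (by simp)).summable.norm
      refine Summable.of_nonneg_of_le (fun _ => by positivity) (fun k => ?_) h
      simp
    · intro y hy
      have hy' : ‖y‖ ≤ 1 := by
        have h : ‖y‖ₑ < 1 := by simpa using hy
        rw [← ofReal_norm, ENNReal.ofReal_lt_one] at h
        exact h.le
      rw [zero_add]
      have h := hF y hy'
      simpa [FormalMultilinearSeries.ofScalars_apply_eq, mul_comm] using h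
  have h1 := hps.hasFPowerSeriesAt
  have h2 := h1.analyticAt.hasFPowerSeriesAt
  have h3 := h1.eq_formalMultilinearSeries h2
  have h4 := congrArg (fun s : FormalMultilinearSeries ℂ ℂ ℂ => s.coeff k) h3
  beta_reduce at h4
  rw [FormalMultilinearSeries.coeff_ofScalars, FormalMultilinearSeries.coeff_ofScalars] at h4
  rw [← h4, Complex.ofReal_re]

/-! ### The logarithm of the generating function of BP -/

/-- The series `∑ c l / (l + 1) * (X ^ (l + 1) - 1)`. -/
noncomputable def logSeries (c : ℕ → ℝ) : PowerSeries ℝ :=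
  PowerSeries.mk fun k => Nat.casesOn k (-∑' l, c l / ((l : ℝ) + 1)) fun l => c l / ((l : ℝ) + 1)

theorem coeff_zero_logSeries (c : ℕ → ℝ) :
    PowerSeries.coeff 0 (logSeries c) = -∑' l, c l / ((l : ℝ) + 1) := by
  rw [logSeries, PowerSeries.coeff_mk]
  rfl

theorem coeff_succ_logSeries (c : ℕ → ℝ) (l : ℕ) :
    PowerSeries.coeff (l + 1) (logSeries c) = c l / ((l : ℝ) + 1) := by
  rw [logSeries, PowerSeries.coeff_mk]

theorem abs_div_succ_le (x : ℝ) (l : ℕ) : |x / ((l : ℝ) + 1)| ≤ |x| := by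
  rw [abs_div, abs_of_nonneg (by positivity : (0 : ℝ) ≤ (l : ℝ) + 1)]
  exact div_le_self (abs_nonneg _) (by linarith [l.cast_nonneg (α := ℝ)])

theorem summable_abs_div_succ {c : ℕ → ℝ} (hc : Summable fun l => |c l|) :
    Summable fun l => |c l / ((l : ℝ) + 1)| :=
  Summable.of_nonneg_of_le (fun _ => abs_nonneg _) (fun l => abs_div_succ_le (c l) l) hc

theorem absSummable_logSeries {c : ℕ → ℝ} (hc : Summable fun l => |c l|) :
    AbsSummable (logSeries c) := by
  unfold AbsSummable
  rw [← summable_nat_add_iff 1]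
  simp only [coeff_succ_logSeries]
  exact summable_abs_div_succ hc

theorem summable_succ_mul_coeff_logSeries {c : ℕ → ℝ} (hc : Summable fun l => |c l|) :
    Summable fun k : ℕ => ((k : ℝ) + 1) * |PowerSeries.coeff (k + 1) (logSeries c)| := by
  refine hc.congr fun l => ?_
  have h : (0 : ℝ) < (l : ℝ) + 1 := by positivity
  rw [coeff_succ_logSeries, abs_div, abs_of_pos h]
  field_simp

theorem seriesVal_logSeries {c : ℕ → ℝ} (hc : Summable fun l => |c l|) {z : ℂ} (hz : ‖z‖ ≤ 1) :
    HasSum (fun l : ℕ => ((c l / ((l : ℝ) + 1) : ℝ) : ℂ) * (z ^ (l + 1) - 1))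
      (seriesVal (logSeries c) z) := by
  have hA := (absSummable_logSeries hc).hasSum hz
  have h1 := (hasSum_nat_add_iff' 1).mpr hA
  simp only [coeff_succ_logSeries, Finset.sum_range_one, pow_zero, mul_one,
    coeff_zero_logSeries] at h1
  have h2 : HasSum (fun l => ((c l / ((l : ℝ) + 1) : ℝ) : ℂ))
      ((∑' l, c l / ((l : ℝ) + 1) : ℝ) : ℂ) := by
    exact_mod_cast (summable_abs_div_succ hc).of_abs.hasSum
  have h3 := h1.sub h2
  convert! h3 using 1
  · funext l; ring
  · push_cast; ring

/-- The coefficients of `z ^ l` in `q / (1 + q z) - x`, where `q = x / (1 - x)`; this is the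
logarithmic derivative of `(1 + x (z - 1)) exp (- x (z - 1))`. -/
noncomputable def factorCoeff (x : ℝ) (l : ℕ) : ℝ :=
  x / (1 - x) * (-(x / (1 - x))) ^ l - if l = 0 then x else 0

/-- The bound by 1/2 keeps the logarithm series convergent on the closed disc, and the linear bound
makes quadratic terms in the odds comparable to `x ^ 2`. -/
theorem odds_bounds {x : ℝ} (h0 : 0 ≤ x) (h1 : x < 1 / 3) :
    0 ≤ x / (1 - x) ∧ x / (1 - x) ≤ 3 / 2 * x ∧ x / (1 - x) < 1 / 2 := by
  have h : 0 < 1 - x := by linarith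
  refine ⟨by positivity, ?_, ?_⟩
  · rw [div_le_iff₀ h]; nlinarith
  · rw [div_lt_iff₀ h]; linarith

/-- At `l = 0` the exponential factor cancels the linear part, leaving `q - x = x q`; for `l ≥ 1`
two powers of `q` are already present. Only `∑ p_i ^ 2 < ∞` is therefore needed. -/
theorem abs_factorCoeff_le {x : ℝ} (h0 : 0 ≤ x) (h1 : x < 1 / 3) (l : ℕ) :
    |factorCoeff x l| ≤ x ^ 2 * (9 * (1 / 2) ^ (l + 1)) := by
  obtain ⟨hq0, hq1, hq2⟩ := odds_bounds h0 h1
  unfold factorCoeff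
  rcases l with _ | l
  · have h : x / (1 - x) - x = x * (x / (1 - x)) := by
      have : 1 - x ≠ 0 := by linarith
      field_simp
      ring
    simp only [pow_zero, mul_one, if_true]
    rw [h, abs_of_nonneg (by positivity)]
    nlinarith
  · set q := x / (1 - x)
    simp only [Nat.succ_ne_zero, if_false, sub_zero]
    rw [abs_mul, abs_pow, abs_neg, abs_of_nonneg hq0]
    have h2 : q ^ l ≤ (1 / 2) ^ l := pow_le_pow_left₀ hq0 hq2.le l
    have h3 : q * q ≤ 9 / 4 * x ^ 2 := by nlinarith
    calc q * q ^ (l + 1) = (q * q) * q ^ l := by ring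
      _ ≤ (9 / 4 * x ^ 2) * (1 / 2) ^ l := by gcongr
      _ = x ^ 2 * (9 * (1 / 2) ^ (l + 1 + 1)) := by ring

theorem summable_geometric_bound : Summable fun l : ℕ => 9 * (1 / 2 : ℝ) ^ (l + 1) :=
  ((summable_nat_add_iff 1).mpr (summable_geometric_of_lt_one (by norm_num)
    (by norm_num : (1 / 2 : ℝ) < 1))).mul_left 9

/-- Since `1 + x (z - 1) = (1 + q z) / (1 + q)`, the logarithm is the difference of the Taylor
series of `log (1 + q w)` at `w = z` and `w = 1`, minus `x (z - 1)`. -/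
theorem factor_eq_exp {x : ℝ} (h0 : 0 ≤ x) (h1 : x < 1 / 3) {z : ℂ} (hz : ‖z‖ ≤ 1) :
    (1 + (x : ℂ) * (z - 1)) * Complex.exp (-((x : ℂ) * (z - 1))) =
      Complex.exp (∑' l : ℕ, ((factorCoeff x l / ((l : ℝ) + 1) : ℝ) : ℂ) * (z ^ (l + 1) - 1)) := by
  obtain ⟨hq0, hq1, hq2⟩ := odds_bounds h0 h1
  set q := x / (1 - x) with hq
  have hlog : ∀ w : ℂ, ‖w‖ ≤ 1 → HasSum (fun l : ℕ =>
      ((q * (-q) ^ l / ((l : ℝ) + 1) : ℝ) : ℂ) * w ^ (l + 1)) (Complex.log (1 + q * w)) ∧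
      1 + (q : ℂ) * w ≠ 0 := by
    intro w hw
    have hlt : ‖(q : ℂ) * w‖ < 1 := by
      rw [norm_mul, Complex.norm_real, Real.norm_eq_abs, abs_of_nonneg hq0]
      nlinarith [norm_nonneg w]
    have h := Complex.hasSum_taylorSeries_log hlt
    have h' := (hasSum_nat_add_iff' 1).mpr h
    simp only [Finset.sum_range_one, Nat.cast_zero, div_zero, sub_zero] at h'
    refine ⟨?_, ?_⟩
    · convert! h' using 1
      funext l
      push_cast
      rw [mul_pow, neg_pow (q : ℂ)]
      ring
    · intro hc
      have : (q : ℂ) * w = -1 := by linear_combination hc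
      rw [this] at hlt
      simp at hlt
  have hone : HasSum (fun l : ℕ => (((if l = 0 then x else 0) / ((l : ℝ) + 1) : ℝ) : ℂ) *
      (z ^ (l + 1) - 1)) ((x : ℂ) * (z - 1)) := by
    convert! hasSum_ite_eq (0 : ℕ) ((x : ℂ) * (z - 1)) using 2 with l
    by_cases hl : l = 0 <;> simp [hl]
  have hs := ((hlog z hz).1.sub (hlog 1 (by simp)).1).sub hone
  have hs' : HasSum (fun l : ℕ => ((factorCoeff x l / ((l : ℝ) + 1) : ℝ) : ℂ) *
      (z ^ (l + 1) - 1))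
      (Complex.log (1 + q * z) - Complex.log (1 + q * 1) - (x : ℂ) * (z - 1)) := by
    convert! hs using 1
    funext l
    unfold factorCoeff
    rw [← hq, one_pow, sub_div]
    push_cast
    ring
  rw [hs'.tsum_eq, sub_eq_add_neg _ ((x : ℂ) * (z - 1)), Complex.exp_add, Complex.exp_sub,
    Complex.exp_log (hlog z hz).2, Complex.exp_log (hlog 1 (by simp)).2]
  congr 1
  rw [eq_div_iff (hlog 1 (by simp)).2]
  have hx : ((1 - x : ℝ) : ℂ) ≠ 0 := by
    exact_mod_cast (by linarith : (1 - x) ≠ 0)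
  have hqx : (q : ℂ) * (1 - x) = x := by
    have : q * (1 - x) = x := by
      rw [hq]
      exact div_mul_cancel₀ _ (by linarith)
    exact_mod_cast this
  linear_combination (1 - z) * hqx

/-- The coefficients of the logarithmic derivative of the generating function of `BP`. -/
noncomputable def bpCoeff (p : ℕ → ℝ) (l : ℕ) : ℝ :=
  ∑' i, factorCoeff (p i) l

section
variable {p : ℕ → ℝ} (h0 : ∀ i, 0 ≤ p i) (h1 : ∀ i, p i < 1 / 3)
  (hs : Summable fun i => p i ^ 2)
include h0 h1 hs

theorem summable_abs_factorCoeff :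
    Summable fun x : ℕ × ℕ => |factorCoeff (p x.1) x.2| :=
  Summable.of_nonneg_of_le (fun _ => abs_nonneg _)
    (fun x => abs_factorCoeff_le (h0 x.1) (h1 x.1) x.2)
    (summable_mul_prod (u := fun i => p i ^ 2) (v := fun l => 9 * (1 / 2 : ℝ) ^ (l + 1)) hs
      summable_geometric_bound)

theorem summable_abs_bpCoeff : Summable fun l => |bpCoeff p l| := by
  have h : Summable fun x : ℕ × ℕ => |factorCoeff (p x.2) x.1| :=
    (summable_abs_factorCoeff h0 h1 hs).prod_symm
  have h' : Summable fun l => ∑' i, |factorCoeff (p i) l| := h.prod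
  exact Summable.of_nonneg_of_le (fun _ => abs_nonneg _)
    (fun l => norm_tsum_le_tsum_norm (f := fun i => factorCoeff (p i) l) (h.prod_factor l)) h'

/-- The logarithms of the factors form an absolutely convergent double series over factors and
powers of `z`; it is summed in the other order and exponentiated. -/
theorem hasProd_bpFactor {z : ℂ} (hz : ‖z‖ ≤ 1) :
    HasProd (bpFactor p z) (Complex.exp (seriesVal (logSeries (bpCoeff p)) z)) := by
  have hsum : Summable fun x : ℕ × ℕ =>
      ((factorCoeff (p x.1) x.2 / ((x.2 : ℝ) + 1) : ℝ) : ℂ) * (z ^ (x.2 + 1) - 1) := by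
    refine Summable.of_norm_bounded ((summable_abs_factorCoeff h0 h1 hs).mul_right 2) fun x => ?_
    rw [norm_mul, Complex.norm_real, Real.norm_eq_abs]
    refine mul_le_mul (abs_div_succ_le _ _) ?_ (norm_nonneg _) (abs_nonneg _)
    refine (norm_sub_le _ _).trans ?_
    rw [norm_pow, norm_one]
    linarith [pow_le_one₀ (norm_nonneg z) hz (n := x.2 + 1)]
  have h2 : HasSum (fun i => ∑' l : ℕ,
      ((factorCoeff (p i) l / ((l : ℝ) + 1) : ℝ) : ℂ) * (z ^ (l + 1) - 1))
      (seriesVal (logSeries (bpCoeff p)) z) := by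
    have h3 := hsum.hasSum.prod_fiberwise fun i => (hsum.prod_factor i).hasSum
    convert! h3 using 1
    rw [← (seriesVal_logSeries (summable_abs_bpCoeff h0 h1 hs) hz).tsum_eq, hsum.tsum_prod]
    dsimp only
    rw [← Summable.tsum_comm (f := fun i l : ℕ =>
        ((factorCoeff (p i) l / ((l : ℝ) + 1) : ℝ) : ℂ) * (z ^ (l + 1) - 1)) hsum]
    refine tsum_congr fun l => ?_
    rw [tsum_mul_right, ← Complex.ofReal_tsum, tsum_div_const, bpCoeff]
  have h4 := h2.cexp
  convert! h4 using 1
  funext i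
  exact factor_eq_exp (h0 i) (h1 i) hz

theorem hasSum_bpGenFun {z : ℂ} (hz : ‖z‖ ≤ 1) :
    HasSum (fun k => ((PowerSeries.coeff k (expSeries (logSeries (bpCoeff p))) : ℝ) : ℂ) * z ^ k)
      (bpGenFun p z) := by
  have hA := absSummable_logSeries (summable_abs_bpCoeff h0 h1 hs)
  rw [bpGenFun, (hasProd_bpFactor h0 h1 hs hz).tprod_eq, ← hA.seriesVal_expSeries hz]
  exact hA.expSeries.hasSum hz

theorem bp_eq_coeff (k : ℕ) :
    bp p k = PowerSeries.coeff k (expSeries (logSeries (bpCoeff p))) :=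
  iteratedDeriv_div_factorial_of_hasSum (fun _ hz => hasSum_bpGenFun h0 h1 hs hz) k

end

/-! ### The generating function of `Po(λ) * BP` and its recursion -/

theorem poissonMass_eq {l : ℝ} (hl : 0 ≤ l) (k : ℕ) :
    poissonMass l k = Real.exp (-l) * l ^ k / (k.factorial : ℝ) := by
  rw [poissonMass, poissonMeasure_real_singleton, Real.coe_toNNReal l hl]

theorem hasSum_poissonMass {l : ℝ} (hl : 0 ≤ l) (z : ℂ) :
    HasSum (fun k => (poissonMass l k : ℂ) * z ^ k) (Complex.exp (l * (z - 1))) := by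
  have h := (NormedSpace.expSeries_div_hasSum_exp ((l : ℂ) * z)).mul_left (Complex.exp (-l))
  rw [← Complex.exp_eq_exp_ℂ, ← Complex.exp_add] at h
  convert! h using 1
  · funext k
    rw [poissonMass_eq hl, mul_pow]
    push_cast
    ring
  · congr 1; ring

theorem eq_coeff_of_hasSum {a b : ℕ → ℝ} {F : ℂ → ℂ}
    (ha : ∀ z : ℂ, ‖z‖ ≤ 1 → HasSum (fun k => (a k : ℂ) * z ^ k) (F z))
    (hb : ∀ z : ℂ, ‖z‖ ≤ 1 → HasSum (fun k => (b k : ℂ) * z ^ k) (F z)) : a = b := by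
  funext k
  rw [← iteratedDeriv_div_factorial_of_hasSum ha, iteratedDeriv_div_factorial_of_hasSum hb]

/-- The coefficients of the logarithmic derivative of the generating function of
`Po(lam) * BP`. -/
noncomputable def approxCoeff (p : ℕ → ℝ) (m : ℝ) (l : ℕ) : ℝ :=
  bpCoeff p l + if l = 0 then m else 0

section
variable {p : ℕ → ℝ} (h0 : ∀ i, 0 ≤ p i) (h1 : ∀ i, p i < 1 / 3)
  (hs : Summable fun i => p i ^ 2)
include h0 h1 hs

theorem summable_abs_approxCoeff (m : ℝ) : Summable fun l => |approxCoeff p m l| := by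
  have h : Summable fun l : ℕ => |if l = 0 then m else 0| :=
    summable_of_ne_finset_zero (s := {0}) fun l hl => by
      simp only [Finset.mem_singleton] at hl
      simp [hl]
  exact Summable.of_nonneg_of_le (fun _ => abs_nonneg _) (fun _ => abs_add_le _ _)
    ((summable_abs_bpCoeff h0 h1 hs).add h)

theorem seriesVal_logSeries_approxCoeff (m : ℝ) {z : ℂ} (hz : ‖z‖ ≤ 1) :
    seriesVal (logSeries (approxCoeff p m)) z =
      m * (z - 1) + seriesVal (logSeries (bpCoeff p)) z := by
  have h1' := seriesVal_logSeries (summable_abs_bpCoeff h0 h1 hs) hz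
  have h2 := seriesVal_logSeries (summable_abs_approxCoeff h0 h1 hs m) hz
  have hone : HasSum (fun l : ℕ => (((if l = 0 then m else 0) / ((l : ℝ) + 1) : ℝ) : ℂ) *
      (z ^ (l + 1) - 1)) ((m : ℂ) * (z - 1)) := by
    convert! hasSum_ite_eq (0 : ℕ) ((m : ℂ) * (z - 1)) using 2 with l
    by_cases hl : l = 0 <;> simp [hl]
  refine h2.unique ?_
  convert! hone.add h1' using 1
  funext l
  unfold approxCoeff
  push_cast
  ring

/-- Both sides have the same generating function on the closed disc, and this determines the
coefficients. -/
theorem conv_poisson_bp_eq_coeff {m : ℝ} (hm : 0 ≤ m) :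
    conv (poissonMass m) (bp p) =
      fun k => PowerSeries.coeff k (expSeries (logSeries (approxCoeff p m))) := by
  have hA := absSummable_logSeries (summable_abs_approxCoeff h0 h1 hs m)
  have hB := absSummable_logSeries (summable_abs_bpCoeff h0 h1 hs)
  have hP : AbsSummable (PowerSeries.mk (poissonMass m)) := by
    have h := (hasSum_poissonMass hm 1).summable.norm
    unfold AbsSummable
    refine h.congr fun k => ?_
    rw [PowerSeries.coeff_mk, one_pow, mul_one, Complex.norm_real, Real.norm_eq_abs]
  have hconv : ∀ k, conv (poissonMass m) (bp p) k =
      PowerSeries.coeff k (PowerSeries.mk (poissonMass m) * expSeries (logSeries (bpCoeff p))) := by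
    intro k
    rw [PowerSeries.coeff_mul, Finset.Nat.sum_antidiagonal_eq_sum_range_succ_mk, conv]
    refine Finset.sum_congr rfl fun j _ => ?_
    rw [PowerSeries.coeff_mk, bp_eq_coeff h0 h1 hs]
  refine eq_coeff_of_hasSum (F := fun z => Complex.exp (seriesVal (logSeries (approxCoeff p m)) z))
    (fun z hz => ?_) (fun z hz => ?_)
  · simp only [hconv]
    rw [seriesVal_logSeries_approxCoeff h0 h1 hs m hz, Complex.exp_add,
      ← hB.seriesVal_expSeries hz, ← (hasSum_poissonMass hm z).tsum_eq]
    have h := (hP.mul hB.expSeries).hasSum hz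
    rw [hP.seriesVal_mul hB.expSeries hz] at h
    simpa only [seriesVal, PowerSeries.coeff_mk] using h
  · rw [← hA.seriesVal_expSeries hz]
    exact hA.expSeries.hasSum hz

theorem isSignedCompoundPoisson_conv {m : ℝ} (hm : 0 ≤ m) :
    IsSignedCompoundPoisson (conv (poissonMass m) (bp p)) := by
  have hc := summable_abs_approxCoeff h0 h1 hs m
  have hA := absSummable_logSeries hc
  rw [conv_poisson_bp_eq_coeff h0 h1 hs hm]
  refine ⟨hA.expSeries, fun l => PowerSeries.coeff l (logSeries (approxCoeff p m)), hA,
    fun z hz => ?_⟩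
  have h := (seriesVal_logSeries hc hz).tsum_eq
  simp only [coeff_succ_logSeries]
  rw [h, ← hA.seriesVal_expSeries hz]
  exact hA.expSeries.hasSum hz

theorem summable_mul_abs_conv {m : ℝ} (hm : 0 ≤ m) :
    Summable fun k : ℕ => (k : ℝ) * |conv (poissonMass m) (bp p) k| := by
  have hc := summable_abs_approxCoeff h0 h1 hs m
  rw [conv_poisson_bp_eq_coeff h0 h1 hs hm]
  exact (absSummable_logSeries hc).summable_mul_coeff_expSeries
    (summable_succ_mul_coeff_logSeries hc)

/-- Every term `z ^ (l + 1) - 1` of the logarithm vanishes at `z = 1`. -/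
theorem tsum_conv_eq_one {m : ℝ} (hm : 0 ≤ m) :
    ∑' k, conv (poissonMass m) (bp p) k = 1 := by
  have hc := summable_abs_approxCoeff h0 h1 hs m
  have hA := absSummable_logSeries hc
  have h := hA.seriesVal_expSeries (z := 1) (by simp)
  have h2 := seriesVal_logSeries hc (z := 1) (by simp)
  simp only [one_pow, sub_self, mul_zero] at h2
  rw [h2.unique hasSum_zero, Complex.exp_zero] at h
  rw [conv_poisson_bp_eq_coeff h0 h1 hs hm]
  simp only [seriesVal, one_pow, mul_one, ← Complex.ofReal_tsum] at h
  exact_mod_cast h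

theorem succ_mul_conv {m : ℝ} (hm : 0 ≤ m) (k : ℕ) :
    ((k : ℝ) + 1) * conv (poissonMass m) (bp p) (k + 1) =
      ∑ x ∈ Finset.HasAntidiagonal.antidiagonal k,
        approxCoeff p m x.1 * conv (poissonMass m) (bp p) x.2 := by
  have hA := absSummable_logSeries (summable_abs_approxCoeff h0 h1 hs m)
  rw [conv_poisson_bp_eq_coeff h0 h1 hs hm]
  rw [hA.coeff_succ_expSeries]
  refine Finset.sum_congr rfl fun x _ => ?_
  rw [coeff_succ_logSeries, mul_div_cancel₀]
  positivity

end

/-! ### The Poisson Stein equation for point indicators -/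

theorem poissonMass_pos {m : ℝ} (hm : 0 < m) (k : ℕ) : 0 < poissonMass m k := by
  rw [poissonMass_eq hm.le]
  positivity

theorem succ_mul_poissonMass {m : ℝ} (hm : 0 ≤ m) (k : ℕ) :
    ((k : ℝ) + 1) * poissonMass m (k + 1) = m * poissonMass m k := by
  rw [poissonMass_eq hm, poissonMass_eq hm, Nat.factorial_succ, pow_succ]
  have h : (k.factorial : ℝ) ≠ 0 := by positivity
  push_cast
  field_simp

theorem hasSum_poissonMass_one {m : ℝ} (hm : 0 ≤ m) : HasSum (poissonMass m) 1 := by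
  have h := hasSum_poissonMass hm 1
  simp only [one_pow, mul_one, sub_self, mul_zero, Complex.exp_zero] at h
  have h' : HasSum (fun k => (poissonMass m k : ℂ)) ((1 : ℝ) : ℂ) := by simpa using h
  exact Complex.hasSum_ofReal.mp h'

/-- The Poisson probability of `{0, …, j - 1}`. -/
noncomputable def poissonLower (m : ℝ) (j : ℕ) : ℝ :=
  ∑ i ∈ Finset.range j, poissonMass m i

theorem poissonLower_succ (m : ℝ) (j : ℕ) :
    poissonLower m (j + 1) = poissonLower m j + poissonMass m j :=
  Finset.sum_range_succ _ _

theorem poissonLower_nonneg (m : ℝ) (j : ℕ) : 0 ≤ poissonLower m j :=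
  Finset.sum_nonneg fun _ _ => measureReal_nonneg

/-- Termwise, `m π(i) = (i + 1) π(i + 1) ≤ j π(i + 1)` for `i < j`. This and the companion bound for
upper tails give the monotonicity of the Stein solutions. -/
theorem mul_poissonLower_le {m : ℝ} (hm : 0 < m) (j : ℕ) :
    m * poissonLower m j ≤ j * poissonLower m (j + 1) := by
  unfold poissonLower
  rw [Finset.sum_range_succ', Finset.mul_sum, mul_add, Finset.mul_sum]
  have h : 0 ≤ (j : ℝ) * poissonMass m 0 := by
    have := (poissonMass_pos hm 0).le
    positivity
  refine le_add_of_le_of_nonneg (Finset.sum_le_sum fun i hi => ?_) h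
  rw [← succ_mul_poissonMass hm.le]
  have hij : (i : ℝ) + 1 ≤ j := by exact_mod_cast Finset.mem_range.mp hi
  exact mul_le_mul_of_nonneg_right hij (poissonMass_pos hm _).le

theorem hasSum_poissonUpper {m : ℝ} (hm : 0 ≤ m) (j : ℕ) :
    HasSum (fun i => poissonMass m (i + j)) (1 - poissonLower m j) :=
  (hasSum_nat_add_iff' j).mpr (hasSum_poissonMass_one hm)

theorem poissonUpper_nonneg {m : ℝ} (hm : 0 ≤ m) (j : ℕ) : 0 ≤ 1 - poissonLower m j :=
  (hasSum_poissonUpper hm j).nonneg fun _ => measureReal_nonneg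

theorem mul_poissonUpper_le {m : ℝ} (hm : 0 < m) (j : ℕ) :
    (j : ℝ) * (1 - poissonLower m (j + 1)) ≤ m * (1 - poissonLower m j) := by
  refine hasSum_le (fun i => ?_) ((hasSum_poissonUpper hm.le (j + 1)).mul_left _)
    ((hasSum_poissonUpper hm.le j).mul_left _)
  rw [← succ_mul_poissonMass hm.le, ← add_assoc]
  refine mul_le_mul_of_nonneg_right ?_ (poissonMass_pos hm _).le
  push_cast
  linarith [i.cast_nonneg (α := ℝ)]

/-- The solution at `j + 1` of the Poisson Stein equation for the indicator of `{k}`. -/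
noncomputable def steinPoint (m : ℝ) (k j : ℕ) : ℝ :=
  if j < k then -(poissonMass m k * (poissonLower m (j + 1) / (m * poissonMass m j)))
  else poissonMass m k * ((1 - poissonLower m (j + 1)) / (m * poissonMass m j))

theorem steinPoint_zero {m : ℝ} (hm : 0 < m) (k : ℕ) :
    m * steinPoint m k 0 = (if k = 0 then 1 else 0) - poissonMass m k := by
  have h := (poissonMass_pos hm 0).ne'
  have h' := hm.ne'
  unfold steinPoint
  rw [poissonLower_succ, poissonLower, Finset.range_zero, Finset.sum_empty, zero_add]
  rcases Nat.eq_zero_or_pos k with rfl | hk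
  · simp only [lt_irrefl, if_false, if_true]
    field_simp
  · rw [if_pos hk, if_neg hk.ne']
    field_simp
    ring

theorem steinPoint_succ {m : ℝ} (hm : 0 < m) (k j : ℕ) :
    m * steinPoint m k (j + 1) - ((j : ℝ) + 1) * steinPoint m k j =
      (if k = j + 1 then 1 else 0) - poissonMass m k := by
  have ha := (poissonMass_pos hm (j + 1)).ne'
  have h' := hm.ne'
  have hj : (j : ℝ) + 1 ≠ 0 := by positivity
  unfold steinPoint
  rw [← succ_mul_poissonMass hm.le j, poissonLower_succ m (j + 1)]
  rcases lt_trichotomy k (j + 1) with hk | rfl | hk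
  · rw [if_neg (by omega), if_neg (by omega), if_neg (by omega)]
    field_simp
    ring
  · simp only [lt_irrefl, if_false, if_true, Nat.lt_succ_self]
    field_simp
    ring
  · rw [if_pos (by omega), if_pos (by omega), if_neg (by omega)]
    field_simp
    ring

/-- To the right of `k` the solution decreases, by the upper tail inequality; the exact increment is
kept because it is summed over `k` later. -/
theorem steinPoint_diff_of_le {m : ℝ} (hm : 0 < m) {k j : ℕ} (h : k ≤ j) :
    |steinPoint m k (j + 1) - steinPoint m k j| = steinPoint m k j - steinPoint m k (j + 1) ∧
    steinPoint m k j - steinPoint m k (j + 1) = poissonMass m k *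
      ((1 - poissonLower m (j + 1)) / (((j : ℝ) + 1) * poissonMass m (j + 1)) -
        (1 - poissonLower m (j + 2)) / (m * poissonMass m (j + 1))) := by
  have h2 : steinPoint m k j - steinPoint m k (j + 1) = poissonMass m k *
      ((1 - poissonLower m (j + 1)) / (((j : ℝ) + 1) * poissonMass m (j + 1)) -
        (1 - poissonLower m (j + 2)) / (m * poissonMass m (j + 1))) := by
    unfold steinPoint
    rw [if_neg (by omega), if_neg (by omega), succ_mul_poissonMass hm.le j]
    ring
  refine ⟨?_, h2⟩
  rw [abs_sub_comm, abs_of_nonneg]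
  rw [h2]
  refine mul_nonneg (poissonMass_pos hm k).le (sub_nonneg.mpr ?_)
  have ha := poissonMass_pos hm (j + 1)
  rw [div_le_div_iff₀ (by positivity) (by positivity)]
  have := mul_poissonUpper_le hm (j + 1)
  push_cast at this
  nlinarith

/-- To the left of `k` the solution also decreases, by the lower tail inequality. Hence the only
upward step is the one from `k - 1` to `k`. -/
theorem steinPoint_diff_of_lt {m : ℝ} (hm : 0 < m) {k j : ℕ} (h : j + 1 < k) :
    |steinPoint m k (j + 1) - steinPoint m k j| = steinPoint m k j - steinPoint m k (j + 1) ∧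
    steinPoint m k j - steinPoint m k (j + 1) = poissonMass m k *
      (poissonLower m (j + 2) / (m * poissonMass m (j + 1)) -
        poissonLower m (j + 1) / (((j : ℝ) + 1) * poissonMass m (j + 1))) := by
  have h2 : steinPoint m k j - steinPoint m k (j + 1) = poissonMass m k *
      (poissonLower m (j + 2) / (m * poissonMass m (j + 1)) -
        poissonLower m (j + 1) / (((j : ℝ) + 1) * poissonMass m (j + 1))) := by
    unfold steinPoint
    rw [if_pos (by omega), if_pos (by omega), succ_mul_poissonMass hm.le j]
    ring
  refine ⟨?_, h2⟩
  rw [abs_sub_comm, abs_of_nonneg]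
  rw [h2]
  refine mul_nonneg (poissonMass_pos hm k).le (sub_nonneg.mpr ?_)
  have ha := poissonMass_pos hm (j + 1)
  rw [div_le_div_iff₀ (by positivity) (by positivity)]
  have := mul_poissonLower_le hm (j + 1)
  push_cast at this
  nlinarith

theorem steinPoint_jump {m : ℝ} (hm : 0 < m) (j : ℕ) :
    steinPoint m (j + 1) (j + 1) - steinPoint m (j + 1) j =
      (1 - poissonLower m (j + 2)) / m + poissonLower m (j + 1) / ((j : ℝ) + 1) := by
  have ha := (poissonMass_pos hm (j + 1)).ne'
  have h' := hm.ne'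
  have hj : (j : ℝ) + 1 ≠ 0 := by positivity
  unfold steinPoint
  rw [if_neg (by omega), if_pos (by omega), ← succ_mul_poissonMass hm.le j]
  field_simp
  ring

theorem steinPoint_jump_bounds {m : ℝ} (hm : 0 < m) (j : ℕ) :
    0 ≤ steinPoint m (j + 1) (j + 1) - steinPoint m (j + 1) j ∧
    steinPoint m (j + 1) (j + 1) - steinPoint m (j + 1) j ≤ 1 / m := by
  have hj : (0 : ℝ) < (j : ℝ) + 1 := by positivity
  rw [steinPoint_jump hm]
  have h1 := poissonUpper_nonneg hm.le (j + 2)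
  have h2 := poissonLower_nonneg m (j + 1)
  refine ⟨by positivity, ?_⟩
  have h3 : poissonLower m (j + 1) / ((j : ℝ) + 1) ≤ poissonLower m (j + 2) / m := by
    rw [div_le_div_iff₀ hj hm]
    have := mul_poissonLower_le hm (j + 1)
    push_cast at this
    linarith
  calc _ ≤ (1 - poissonLower m (j + 2)) / m + poissonLower m (j + 2) / m := by linarith
    _ = 1 / m := by ring

/-- For fixed `j` only `k = j + 1` contributes a positive increment, `c ≤ 1/m`. The increments over
all `k` add up to zero, so the absolute values total `2 c`. -/
theorem abs_steinPoint_diff_le {m : ℝ} (hm : 0 < m) (j N : ℕ) :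
    ∑ k ∈ Finset.range N, |steinPoint m k (j + 1) - steinPoint m k j| ≤ 2 / m := by
  have ha := poissonMass_pos hm (j + 1)
  have hj : (0 : ℝ) < (j : ℝ) + 1 := by positivity
  set c := steinPoint m (j + 1) (j + 1) - steinPoint m (j + 1) j with hc
  obtain ⟨hc0, hc1⟩ := steinPoint_jump_bounds hm j
  have hcj := steinPoint_jump hm j
  rw [← hc] at hc0 hc1 hcj
  have hmono : ∑ k ∈ Finset.range N, |steinPoint m k (j + 1) - steinPoint m k j| ≤
      ∑ k ∈ Finset.range ((j + 2) + N), |steinPoint m k (j + 1) - steinPoint m k j| :=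
    Finset.sum_le_sum_of_subset_of_nonneg (Finset.range_mono (by omega))
      fun _ _ _ => abs_nonneg _
  refine hmono.trans ?_
  rw [Finset.sum_range_add, Finset.sum_range_succ, ← hc, abs_of_nonneg hc0]
  have h1 : ∑ k ∈ Finset.range (j + 1), |steinPoint m k (j + 1) - steinPoint m k j| =
      poissonLower m (j + 1) *
      ((1 - poissonLower m (j + 1)) / (((j : ℝ) + 1) * poissonMass m (j + 1)) -
        (1 - poissonLower m (j + 2)) / (m * poissonMass m (j + 1))) := by
    rw [poissonLower, Finset.sum_mul]
    refine Finset.sum_congr rfl fun k hk => ?_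
    obtain ⟨e1, e2⟩ := steinPoint_diff_of_le hm (Nat.lt_succ_iff.mp (Finset.mem_range.mp hk))
    rw [e1, e2]
    rfl
  set a := poissonLower m (j + 2) / (m * poissonMass m (j + 1)) -
        poissonLower m (j + 1) / (((j : ℝ) + 1) * poissonMass m (j + 1)) with hadef
  have h2 : ∑ i ∈ Finset.range N,
      |steinPoint m (j + 2 + i) (j + 1) - steinPoint m (j + 2 + i) j| ≤
      (1 - poissonLower m (j + 2)) * a := by
    have e : ∀ i, |steinPoint m (j + 2 + i) (j + 1) - steinPoint m (j + 2 + i) j| =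
        poissonMass m (i + (j + 2)) * a := fun i => by
      obtain ⟨e1, e2⟩ := steinPoint_diff_of_lt hm (show j + 1 < j + 2 + i by omega)
      rw [e1, e2, add_comm (j + 2) i]
    -- The case `k = j + 2` exhibits a positive multiple of `a` as an absolute value.
    have hn : 0 ≤ a := by
      have h := e 0
      have h' := poissonMass_pos hm (0 + (j + 2))
      by_contra hneg
      have := abs_nonneg (steinPoint m (j + 2 + 0) (j + 1) - steinPoint m (j + 2 + 0) j)
      nlinarith
    simp only [e]
    rw [← Finset.sum_mul]
    exact mul_le_mul_of_nonneg_right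
      (sum_le_hasSum _ (fun _ _ => measureReal_nonneg) (hasSum_poissonUpper hm.le (j + 2))) hn
  -- The decreases balance the jump because the constant function 1 has Stein solution zero.
  have h3 : poissonLower m (j + 1) *
      ((1 - poissonLower m (j + 1)) / (((j : ℝ) + 1) * poissonMass m (j + 1)) -
        (1 - poissonLower m (j + 2)) / (m * poissonMass m (j + 1))) +
      (1 - poissonLower m (j + 2)) * a = c := by
    rw [hcj, hadef, poissonLower_succ m (j + 1)]
    have := ha.ne'
    have := hm.ne'
    have := hj.ne'
    field_simp
    ring
  have h4 : (2 : ℝ) / m = 1 / m + 1 / m := by ring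
  rw [h1, h4]
  linarith

theorem steinPoint_nonneg {m : ℝ} (hm : 0 < m) {k j : ℕ} (h : k ≤ j) :
    0 ≤ steinPoint m k j := by
  unfold steinPoint
  rw [if_neg (by omega)]
  have h1 := poissonUpper_nonneg hm.le (j + 1)
  have h2 := poissonMass_pos hm j
  have h3 := poissonMass_pos hm k
  positivity

theorem steinPoint_nonpos {m : ℝ} (hm : 0 < m) {k j : ℕ} (h : j < k) :
    steinPoint m k j ≤ 0 := by
  unfold steinPoint
  rw [if_pos h]
  have h1 := poissonLower_nonneg m (j + 1)
  have h2 := poissonMass_pos hm j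
  have h3 := poissonMass_pos hm k
  exact neg_nonpos.mpr (by positivity)

theorem steinPoint_zero_le {m : ℝ} (hm : 0 < m) : steinPoint m 0 0 ≤ 1 / m := by
  have h := steinPoint_zero hm 0
  have h2 := poissonMass_pos hm 0
  rw [le_div_iff₀ hm]
  simp only [if_true] at h
  linarith

/-- For `k ≥ 1` the solution falls from a value `≤ 0`, jumps up at `k`, then falls while staying `≥
0`. The two descents together cost at most the jump, so the variation is at most twice the jump. -/
theorem sum_abs_steinPoint_diff_le {m : ℝ} (hm : 0 < m) (k N : ℕ) :
    ∑ j ∈ Finset.range N, |steinPoint m k (j + 1) - steinPoint m k j| ≤ 2 / m := by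
  have h4 : (2 : ℝ) / m = 1 / m + 1 / m := by ring
  have hm1 : 0 < 1 / m := by positivity
  rcases k with _ | k
  · have h : ∀ j, |steinPoint m 0 (j + 1) - steinPoint m 0 j| =
        steinPoint m 0 j - steinPoint m 0 (j + 1) :=
      fun j => (steinPoint_diff_of_le hm (Nat.zero_le j)).1
    simp only [h]
    rw [Finset.sum_range_sub', h4]
    have := steinPoint_zero_le hm
    have := steinPoint_nonneg hm (Nat.zero_le N)
    linarith
  · have hmono : ∑ j ∈ Finset.range N, |steinPoint m (k + 1) (j + 1) - steinPoint m (k + 1) j| ≤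
        ∑ j ∈ Finset.range ((k + 1) + N),
          |steinPoint m (k + 1) (j + 1) - steinPoint m (k + 1) j| :=
      Finset.sum_le_sum_of_subset_of_nonneg (Finset.range_mono (by omega))
        fun _ _ _ => abs_nonneg _
    refine hmono.trans ?_
    obtain ⟨hc0, hc1⟩ := steinPoint_jump_bounds hm k
    rw [Finset.sum_range_add, Finset.sum_range_succ, abs_of_nonneg hc0]
    have h1 : ∑ j ∈ Finset.range k, |steinPoint m (k + 1) (j + 1) - steinPoint m (k + 1) j| =
        steinPoint m (k + 1) 0 - steinPoint m (k + 1) k := by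
      rw [← Finset.sum_range_sub']
      refine Finset.sum_congr rfl fun j hj => ?_
      have := Finset.mem_range.mp hj
      exact (steinPoint_diff_of_lt hm (by omega)).1
    have h2 : ∑ i ∈ Finset.range N,
        |steinPoint m (k + 1) (k + 1 + i + 1) - steinPoint m (k + 1) (k + 1 + i)| =
        steinPoint m (k + 1) (k + 1) - steinPoint m (k + 1) (k + 1 + N) := by
      rw [← Finset.sum_range_sub' (fun i => steinPoint m (k + 1) (k + 1 + i))]
      exact Finset.sum_congr rfl fun i _ => (steinPoint_diff_of_le hm (by omega)).1
    rw [h1, h2, h4]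
    have := steinPoint_nonpos hm (Nat.succ_pos k)
    have := steinPoint_nonneg hm (show k + 1 ≤ k + 1 + N by omega)
    linarith

theorem exists_abs_steinPoint_le {m : ℝ} (hm : 0 < m) (k : ℕ) :
    ∃ C, ∀ j, |steinPoint m k j| ≤ C := by
  refine ⟨|steinPoint m k 0| + 2 / m, fun j => ?_⟩
  have h1 : steinPoint m k j - steinPoint m k 0 =
      ∑ i ∈ Finset.range j, (steinPoint m k (i + 1) - steinPoint m k i) :=
    (Finset.sum_range_sub _ _).symm
  have h2 := (Finset.abs_sum_le_sum_abs (fun i => steinPoint m k (i + 1) - steinPoint m k i)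
    (Finset.range j)).trans (sum_abs_steinPoint_diff_le hm k j)
  rw [← h1] at h2
  have h3 := abs_sub_abs_le_abs_sub (steinPoint m k j) (steinPoint m k 0)
  linarith

/-! ### Maximum and total variation of the Poisson probabilities -/

/-- The Poisson probability of `{k}` as a function of a real mean. -/
noncomputable def poissonTerm (x : ℝ) (k : ℕ) : ℝ :=
  Real.exp (-x) * x ^ k / (k.factorial : ℝ)

theorem poissonTerm_nonneg {x : ℝ} (hx : 0 ≤ x) (k : ℕ) : 0 ≤ poissonTerm x k := by
  unfold poissonTerm
  positivity

theorem succ_mul_poissonTerm (x : ℝ) (k : ℕ) :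
    ((k : ℝ) + 1) * poissonTerm x (k + 1) = x * poissonTerm x k := by
  unfold poissonTerm
  rw [Nat.factorial_succ, pow_succ]
  have h : (k.factorial : ℝ) ≠ 0 := by positivity
  push_cast
  field_simp

/-- `poissonTerm x (k - 1)`, read as `0` at `k = 0`. -/
noncomputable def poissonPrev (x : ℝ) : ℕ → ℝ
  | 0 => 0
  | k + 1 => poissonTerm x k

theorem poissonPrev_zero (x : ℝ) : poissonPrev x 0 = 0 := rfl

theorem poissonPrev_succ (x : ℝ) (k : ℕ) : poissonPrev x (k + 1) = poissonTerm x k := rfl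

theorem hasDerivAt_poissonTerm (x : ℝ) (k : ℕ) :
    HasDerivAt (fun y => poissonTerm y k) (poissonPrev x k - poissonTerm x k) x := by
  have he : HasDerivAt (fun y : ℝ => Real.exp (-y)) (-Real.exp (-x)) x := by
    simpa using (hasDerivAt_neg x).exp
  unfold poissonTerm
  have h := (he.mul (hasDerivAt_pow k x)).div_const (k.factorial : ℝ)
  refine h.congr_deriv ?_
  rcases k with _ | k
  · simp [poissonPrev]
  · have hk : (k.factorial : ℝ) ≠ 0 := by positivity
    simp only [poissonPrev, poissonTerm, Nat.factorial_succ, Nat.add_sub_cancel]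
    push_cast
    field_simp
    ring

/-- `ln k! ≥ (k + 1/2) ln (k + 1/2) - k + (ln 2) / 2`. -/
theorem log_factorial_ge (k : ℕ) :
    ((k : ℝ) + 1 / 2) * Real.log ((k : ℝ) + 1 / 2) - k + Real.log 2 / 2 ≤
      Real.log (k.factorial : ℝ) := by
  induction k with
  | zero =>
    have : Real.log (1 / 2) = -Real.log 2 := by rw [one_div, Real.log_inv]
    simp only [Nat.cast_zero, zero_add, Nat.factorial_zero, Nat.cast_one, Real.log_one]
    rw [this]
    linarith
  | succ k ih =>
    have hk : (0 : ℝ) ≤ k := k.cast_nonneg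
    -- Concavity: `log` lies below its tangent at the midpoint `k + 1`, whose integral over this
    -- unit interval is `log (k + 1)`.
    have hint : ∫ t in ((k : ℝ) + 1 / 2)..((k : ℝ) + 3 / 2), Real.log t ≤
        ∫ t in ((k : ℝ) + 1 / 2)..((k : ℝ) + 3 / 2),
          ((Real.log ((k : ℝ) + 1) - 1) + t * ((k : ℝ) + 1)⁻¹) := by
      refine intervalIntegral.integral_mono_on (by linarith) intervalIntegral.intervalIntegrable_log'
        (Continuous.intervalIntegrable (by fun_prop) _ _) fun t ht => ?_
      have ht0 : 0 < t := by linarith [ht.1]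
      have h := Real.log_le_sub_one_of_pos (show 0 < t / ((k : ℝ) + 1) by positivity)
      rw [Real.log_div ht0.ne' (by positivity), div_eq_mul_inv] at h
      linarith
    rw [integral_log, intervalIntegral.integral_add (by simp)
      (Continuous.intervalIntegrable (by fun_prop) _ _), intervalIntegral.integral_const,
      intervalIntegral.integral_mul_const, integral_id, smul_eq_mul] at hint
    have h2 : (((k : ℝ) + 3 / 2) ^ 2 - ((k : ℝ) + 1 / 2) ^ 2) / 2 * ((k : ℝ) + 1)⁻¹ = 1 := by
      field_simp
      ring
    rw [h2] at hint
    rw [Nat.factorial_succ, Nat.cast_mul, Real.log_mul (by positivity) (by positivity)]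
    push_cast
    have e : (k : ℝ) + 1 + 1 / 2 = (k : ℝ) + 3 / 2 := by ring
    rw [e]
    linarith

/-- After taking logarithms, insert the factorial bound and apply `log y ≤ y - 1` at `y = x / (k +
1/2)`; all dependence on `k` cancels. -/
theorem poissonTerm_le {x : ℝ} (hx : 0 < x) (k : ℕ) :
    poissonTerm x k ≤ 1 / Real.sqrt (2 * Real.exp 1 * x) := by
  have hpos : 0 < poissonTerm x k := by unfold poissonTerm; positivity
  have hs : 0 < 2 * Real.exp 1 * x := by positivity
  rw [← Real.log_le_log_iff hpos (by positivity), one_div, Real.log_inv,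
    Real.log_sqrt hs.le, Real.log_mul (by positivity) hx.ne',
    Real.log_mul (by norm_num) (Real.exp_pos 1).ne', Real.log_exp]
  unfold poissonTerm
  rw [Real.log_div (by positivity) (by positivity), Real.log_mul (Real.exp_pos _).ne'
    (by positivity), Real.log_exp, Real.log_pow]
  have h1 := log_factorial_ge k
  have hk : (0 : ℝ) < (k : ℝ) + 1 / 2 := by positivity
  have h := Real.log_le_sub_one_of_pos (show 0 < x / ((k : ℝ) + 1 / 2) by positivity)
  rw [Real.log_div hx.ne' hk.ne'] at h
  have h3 := mul_le_mul_of_nonneg_left h hk.le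
  have h4 : ((k : ℝ) + 1 / 2) * (x / ((k : ℝ) + 1 / 2) - 1) = x - ((k : ℝ) + 1 / 2) := by
    field_simp
  rw [h4] at h3
  linarith

/-- Unimodality: the probabilities rise up to the mean and fall afterwards, so both monotone
stretches telescope to at most the maximum. -/
theorem sum_abs_poissonTerm_diff_le {x M : ℝ} (hx : 0 ≤ x) (hM : ∀ k, poissonTerm x k ≤ M)
    (N : ℕ) : ∑ k ∈ Finset.range N, |poissonPrev x k - poissonTerm x k| ≤ 2 * M := by
  have hM0 : 0 ≤ M := (poissonTerm_nonneg hx 0).trans (hM 0)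
  have key : ∀ N : ℕ, ((N : ℝ) ≤ x →
      ∑ k ∈ Finset.range (N + 1), |poissonPrev x k - poissonTerm x k| ≤ poissonTerm x N) ∧
      (x < N → ∑ k ∈ Finset.range (N + 1), |poissonPrev x k - poissonTerm x k| ≤
        2 * M - poissonTerm x N) := by
    intro N
    induction N with
    | zero =>
      refine ⟨fun _ => ?_, fun h => absurd h (by simpa using hx)⟩
      simp [poissonPrev, abs_of_nonneg (poissonTerm_nonneg hx 0)]
    | succ N ih =>
      have hr := succ_mul_poissonTerm x N
      have ht := poissonTerm_nonneg hx N
      have ht' := poissonTerm_nonneg hx (N + 1)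
      have hN : (0 : ℝ) < (N : ℝ) + 1 := by positivity
      rw [Finset.sum_range_succ _ (N + 1)]
      rw [poissonPrev_succ]
      push_cast
      refine ⟨fun h => ?_, fun h => ?_⟩
      · have hle : poissonTerm x N ≤ poissonTerm x (N + 1) := by nlinarith
        rw [abs_of_nonpos (by linarith)]
        linarith [ih.1 (by linarith)]
      · have hle : poissonTerm x (N + 1) ≤ poissonTerm x N := by nlinarith
        rw [abs_of_nonneg (by linarith)]
        rcases le_or_gt (N : ℝ) x with h' | h'
        · linarith [ih.1 h', hM N]
        · linarith [ih.2 h']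
  rcases N with _ | N
  · simpa using hM0
  · rcases le_or_gt (N : ℝ) x with h' | h'
    · linarith [(key N).1 h', hM N]
    · linarith [(key N).2 h', poissonTerm_nonneg hx N]

/-! ### Immigration-death interpolation and the Stein factor for Lipschitz functions -/

/-- The forward difference. -/
def fwd (f : ℕ → ℝ) (k : ℕ) : ℝ := f (k + 1) - f k

/-- The Poisson expectation of a function vanishing outside `{0, …, N - 1}`. -/
noncomputable def poissonSum (N : ℕ) (x : ℝ) (f : ℕ → ℝ) : ℝ :=
  ∑ k ∈ Finset.range N, poissonTerm x k * f k

/-- Summation by parts; the boundary term disappears because `f N = 0`. -/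
theorem poissonSum_fwd {N : ℕ} (x : ℝ) {f : ℕ → ℝ} (hf : ∀ k, N ≤ k → f k = 0) :
    poissonSum N x (fwd f) = ∑ k ∈ Finset.range N, (poissonPrev x k - poissonTerm x k) * f k := by
  have h1 := Finset.sum_range_succ' (fun k => poissonPrev x k * f k) N
  rw [Finset.sum_range_succ, hf N le_rfl] at h1
  simp only [poissonPrev_zero, poissonPrev_succ, zero_mul, mul_zero, add_zero] at h1
  simp only [poissonSum, fwd, mul_sub, sub_mul, Finset.sum_sub_distrib, h1]

theorem hasDerivAt_poissonSum {N : ℕ} (x : ℝ) {f : ℕ → ℝ} (hf : ∀ k, N ≤ k → f k = 0) :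
    HasDerivAt (fun y => poissonSum N y f) (poissonSum N x (fwd f)) x := by
  rw [poissonSum_fwd x hf]
  unfold poissonSum
  exact HasDerivAt.fun_sum fun k _ => (hasDerivAt_poissonTerm x k).mul_const (f k)

/-- The expectation of `f` under the convolution of the Poisson law with mean `m * s` and the
binomial law with parameters `j` and `1 - s` (an immigration-death process started at `j`), for
`f` vanishing outside `{0, …, N - 1}`. -/
noncomputable def immDeath (N : ℕ) (m : ℝ) : ℕ → ℝ → (ℕ → ℝ) → ℝ
  | 0, s, f => poissonSum N (m * s) f
  | j + 1, s, f => (1 - s) * immDeath N m j s (fun k => f (k + 1)) + s * immDeath N m j s f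

theorem immDeath_sub (N : ℕ) (m : ℝ) (j : ℕ) (s : ℝ) (f g : ℕ → ℝ) :
    immDeath N m j s (fun k => f k - g k) = immDeath N m j s f - immDeath N m j s g := by
  induction j generalizing f g with
  | zero => simp only [immDeath, poissonSum, mul_sub, Finset.sum_sub_distrib]
  | succ j ih =>
    simp only [immDeath]
    rw [ih, ih]
    ring

theorem immDeath_fwd (N : ℕ) (m : ℝ) (j : ℕ) (s : ℝ) (f : ℕ → ℝ) :
    immDeath N m j s (fwd f) = immDeath N m j s (fun k => f (k + 1)) - immDeath N m j s f :=
  immDeath_sub N m j s _ _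

/-- One more initial individual survives with probability `1 - s` and then shifts the law by one.
This damping factor enters the final integral. -/
theorem immDeath_succ_sub (N : ℕ) (m : ℝ) (j : ℕ) (s : ℝ) (f : ℕ → ℝ) :
    immDeath N m (j + 1) s f - immDeath N m j s f = (1 - s) * immDeath N m j s (fwd f) := by
  rw [immDeath_fwd]
  simp only [immDeath]
  ring

/-- Immigration moves the law up at rate `m`, and each of the `j` initial individuals dies at rate 1
in the variable `s`. The truncated `j - 1` at `j = 0` is multiplied by 0. -/
theorem hasDerivAt_immDeath {N : ℕ} (m : ℝ) (j : ℕ) (s : ℝ) {f : ℕ → ℝ}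
    (hf : ∀ k, N ≤ k → f k = 0) :
    HasDerivAt (fun t => immDeath N m j t f)
      (m * immDeath N m j s (fwd f) - j * immDeath N m (j - 1) s (fwd f)) s := by
  induction j generalizing f with
  | zero =>
    simp only [immDeath, Nat.cast_zero, zero_mul, sub_zero]
    have h1 : HasDerivAt (fun t : ℝ => m * t) m s := by
      simpa using (hasDerivAt_id s).const_mul m
    have h := (hasDerivAt_poissonSum (m * s) hf).comp s h1
    rw [mul_comm m]
    exact h
  | succ j ih =>
    have hf' : ∀ k, N ≤ k → f (k + 1) = 0 := fun k hk => hf _ (by omega)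
    have h1 : HasDerivAt (fun t : ℝ => 1 - t) (-1) s := by
      simpa using (hasDerivAt_id s).const_sub 1
    have h := (h1.mul (ih hf')).add ((hasDerivAt_id s).mul (ih hf))
    simp only [immDeath]
    refine h.congr_deriv ?_
    have e : fwd (fun k => f (k + 1)) = fun k => fwd f (k + 1) := rfl
    rw [e, Nat.add_sub_cancel, immDeath_fwd N m j s f]
    rcases j with _ | j
    · simp only [Nat.cast_zero, id, immDeath, Nat.cast_one, zero_add]
      ring
    · rw [Nat.add_sub_cancel]
      have e2 : immDeath N m (j + 1) s (fun k => f (k + 1)) - immDeath N m (j + 1) s f =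
        (1 - s) * immDeath N m j s (fun k => fwd f (k + 1)) + s * immDeath N m j s (fwd f) := by
        rw [← immDeath_fwd]
        rfl
      push_cast
      simp only [id]
      linear_combination ((j : ℝ) + 1) * e2

theorem continuous_immDeath {N : ℕ} (m : ℝ) (j : ℕ) {f : ℕ → ℝ}
    (hf : ∀ k, N ≤ k → f k = 0) : Continuous fun s => immDeath N m j s f :=
  continuous_iff_continuousAt.mpr fun s => (hasDerivAt_immDeath m j s hf).continuousAt

theorem immDeath_at_zero {N : ℕ} (m : ℝ) (j : ℕ) {f : ℕ → ℝ} (hf : ∀ k, N ≤ k → f k = 0) :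
    immDeath N m j 0 f = f j := by
  induction j generalizing f with
  | zero =>
    simp only [immDeath, poissonSum, mul_zero, poissonTerm]
    rcases N with _ | N
    · simp [hf 0 le_rfl]
    · rw [Finset.sum_range_succ']
      simp
  | succ j ih =>
    simp only [immDeath]
    rw [ih (f := fun k => f (k + 1)) fun k hk => hf _ (by omega)]
    ring

theorem immDeath_at_one (N : ℕ) (m : ℝ) (j : ℕ) (f : ℕ → ℝ) :
    immDeath N m j 1 f = poissonSum N m f := by
  induction j with
  | zero => simp only [immDeath, mul_one]
  | succ j ih =>
    simp only [immDeath]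
    rw [ih]
    ring

theorem fwd_eq_zero {N : ℕ} {f : ℕ → ℝ} (hf : ∀ k, N ≤ k → f k = 0) (k : ℕ) (hk : N ≤ k) :
    fwd f k = 0 := by
  rw [fwd, hf _ hk, hf _ (by omega), sub_zero]

/-- Moving the difference onto the Poisson part of the convolution bounds it by the variation of the
Poisson law with mean `m s`. Mixing over survivors preserves the bound. -/
theorem abs_immDeath_fwd_le {N : ℕ} {m : ℝ} (hm : 0 < m) (j : ℕ) {s : ℝ} (hs0 : 0 < s)
    (hs1 : s ≤ 1) {h : ℕ → ℝ} (hN : ∀ k, N ≤ k → h k = 0) (hh : ∀ k, |h k| ≤ 1) :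
    |immDeath N m j s (fwd h)| ≤ 2 * (1 / Real.sqrt (2 * Real.exp 1 * (m * s))) := by
  induction j generalizing h with
  | zero =>
    have hms : 0 < m * s := by positivity
    simp only [immDeath]
    rw [poissonSum_fwd _ hN]
    refine ((Finset.abs_sum_le_sum_abs _ _).trans (Finset.sum_le_sum fun k _ => ?_)).trans
      (sum_abs_poissonTerm_diff_le hms.le (poissonTerm_le hms) N)
    rw [abs_mul]
    exact mul_le_of_le_one_right (abs_nonneg _) (hh k)
  | succ j ih =>
    have h1 := ih hN hh
    have h2 := ih (h := fun k => h (k + 1)) (fun k hk => hN _ (by omega)) fun k => hh _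
    simp only [immDeath]
    have e : fwd (fun k => h (k + 1)) = fun k => fwd h (k + 1) := rfl
    rw [e] at h2
    refine (abs_add_le _ _).trans ?_
    rw [abs_mul, abs_mul, abs_of_nonneg hs0.le, abs_of_nonneg (by linarith : 0 ≤ 1 - s)]
    nlinarith

theorem stein_unique {m c : ℝ} (hm : 0 < m) {f u v : ℕ → ℝ} (hu0 : m * u 0 = f 0 - c)
    (hu : ∀ j : ℕ, m * u (j + 1) - ((j : ℝ) + 1) * u j = f (j + 1) - c) (hv0 : m * v 0 = f 0 - c)
    (hv : ∀ j : ℕ, m * v (j + 1) - ((j : ℝ) + 1) * v j = f (j + 1) - c) (j : ℕ) : u j = v j := by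
  induction j with
  | zero => exact mul_left_cancel₀ hm.ne' (hu0.trans hv0.symm)
  | succ j ih =>
    refine mul_left_cancel₀ hm.ne' ?_
    have h1 := hu j
    have h2 := hv j
    rw [ih] at h1
    linarith

/-- Integrating the derivative from `s = 0` (point mass at `j`) to `s = 1` (Poisson law) shows that
minus the integral of `immDeath N m j s (fwd f)` solves the Stein equation. -/
theorem integral_immDeath_fwd {N : ℕ} (m : ℝ) (j : ℕ) {f : ℕ → ℝ} (hf : ∀ k, N ≤ k → f k = 0) :
    m * (∫ s in (0 : ℝ)..1, immDeath N m j s (fwd f)) -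
      j * (∫ s in (0 : ℝ)..1, immDeath N m (j - 1) s (fwd f)) = poissonSum N m f - f j := by
  have hc : ∀ j, Continuous fun s => immDeath N m j s (fwd f) :=
    fun j => continuous_immDeath m j (fwd_eq_zero hf)
  rw [← immDeath_at_one N m j f, ← immDeath_at_zero m j hf,
    ← intervalIntegral.integral_eq_sub_of_hasDerivAt (f := fun t => immDeath N m j t f)
      (fun s _ => hasDerivAt_immDeath m j s hf)
      (Continuous.intervalIntegrable
        (((hc j).const_mul m).sub ((hc (j - 1)).const_mul (j : ℝ))) _ _),
    intervalIntegral.integral_sub (((hc j).const_mul m).intervalIntegrable _ _)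
      (((hc (j - 1)).const_mul (j : ℝ)).intervalIntegrable _ _),
    intervalIntegral.integral_const_mul, intervalIntegral.integral_const_mul]

theorem abs_integral_immDeath_le {N : ℕ} {m : ℝ} (hm : 0 < m) (j : ℕ) {h : ℕ → ℝ}
    (hN : ∀ k, N ≤ k → h k = 0) (hh : ∀ k, |h k| ≤ 1) :
    |∫ s in (0 : ℝ)..1, (1 - s) * immDeath N m j s (fwd h)| ≤ 1.15 / Real.sqrt m := by
  set K : ℝ := 2 / Real.sqrt (2 * Real.exp 1 * m) with hK
  -- The integrand dominates because `(1 - s) s^(-1/2) = s^(-1/2) - s^(1/2)`, and `2 - 2/3 = 4/3`.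
  have hint : ∫ s in (0 : ℝ)..1, (K * s ^ (-(1 / 2) : ℝ) - K * s ^ (1 / 2 : ℝ)) = 4 / 3 * K := by
    rw [intervalIntegral.integral_sub, intervalIntegral.integral_const_mul,
      intervalIntegral.integral_const_mul, integral_rpow (by norm_num),
      integral_rpow (by norm_num)]
    · norm_num
      ring
    · exact (intervalIntegral.intervalIntegrable_rpow' (by norm_num)).const_mul K
    · exact (intervalIntegral.intervalIntegrable_rpow' (by norm_num)).const_mul K
  have hle := intervalIntegral.norm_integral_le_of_norm_le (a := 0) (b := 1) (μ := volume)
    (f := fun s => (1 - s) * immDeath N m j s (fwd h))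
    (g := fun s => K * s ^ (-(1 / 2) : ℝ) - K * s ^ (1 / 2 : ℝ)) zero_le_one
    (Filter.Eventually.of_forall fun s hs => by
      have hs0 : 0 < s := hs.1
      have hb := abs_immDeath_fwd_le hm j hs0 hs.2 hN hh
      have e1 : 2 * (1 / Real.sqrt (2 * Real.exp 1 * (m * s))) = K * s ^ (-(1 / 2) : ℝ) := by
        rw [hK, ← mul_assoc, Real.sqrt_mul (by positivity), Real.rpow_neg hs0.le,
          ← Real.sqrt_eq_rpow]
        have := (Real.sqrt_pos.mpr hs0).ne'
        have := (Real.sqrt_pos.mpr (show 0 < 2 * Real.exp 1 * m by positivity)).ne'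
        field_simp
      have e2 : s ^ (1 / 2 : ℝ) = s * s ^ (-(1 / 2) : ℝ) := by
        rw [← Real.rpow_one_add' hs0.le (by norm_num)]
        norm_num
      rw [e1] at hb
      rw [norm_mul, Real.norm_eq_abs, Real.norm_eq_abs,
        abs_of_nonneg (by linarith [hs.2] : 0 ≤ 1 - s), e2]
      calc (1 - s) * |immDeath N m j s (fwd h)| ≤ (1 - s) * (K * s ^ (-(1 / 2) : ℝ)) :=
            mul_le_mul_of_nonneg_left hb (by linarith [hs.2])
        _ = _ := by ring)
    (((intervalIntegral.intervalIntegrable_rpow' (by norm_num)).const_mul K).sub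
      ((intervalIntegral.intervalIntegrable_rpow' (by norm_num)).const_mul K))
  rw [hint, Real.norm_eq_abs] at hle
  refine hle.trans ?_
  have hsm := Real.sqrt_pos.mpr hm
  -- The exact constant obtained is `(8/3) / √(2e)`, about 1.144.
  have he : (8 / 3 / 1.15 : ℝ) ≤ Real.sqrt (2 * Real.exp 1) := by
    refine Real.le_sqrt_of_sq_le ?_
    have := Real.exp_one_gt_d9
    norm_num
    linarith
  rw [hK, Real.sqrt_mul (by positivity), ← mul_div_assoc, div_le_div_iff₀ (by positivity) hsm]
  have h2 : (0 : ℝ) ≤ 1.15 * Real.sqrt m := by positivity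
  calc 4 / 3 * 2 * Real.sqrt m = (8 / 3 / 1.15) * (1.15 * Real.sqrt m) := by ring
    _ ≤ Real.sqrt (2 * Real.exp 1) * (1.15 * Real.sqrt m) := mul_le_mul_of_nonneg_right he h2
    _ = _ := by ring

/-- The increments of the Poisson Stein solution of a Lipschitz function. -/
theorem abs_stein_diff_le_of_lipschitz {N : ℕ} {m : ℝ} (hm : 0 < m) {f u : ℕ → ℝ}
    (hN : ∀ k, N ≤ k → f k = 0) (hf : ∀ k, |f (k + 1) - f k| ≤ 1)
    (hu0 : m * u 0 = f 0 - poissonSum N m f)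
    (hu : ∀ j : ℕ, m * u (j + 1) - ((j : ℝ) + 1) * u j = f (j + 1) - poissonSum N m f) (j : ℕ) :
    |u (j + 1) - u j| ≤ 1.15 / Real.sqrt m := by
  -- The forward recursion has only one solution, so the increments of `u` become integrals of
  -- second differences of `f`.
  have key := stein_unique hm hu0 hu (v := fun j => -∫ s in (0 : ℝ)..1, immDeath N m j s (fwd f))
    (by
      have := integral_immDeath_fwd m 0 hN
      simp only [Nat.cast_zero, zero_mul, sub_zero] at this
      linarith)
    (fun j => by
      have := integral_immDeath_fwd m (j + 1) hN
      rw [Nat.add_sub_cancel] at this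
      push_cast at this
      linarith)
  have hc : ∀ j, Continuous fun s => immDeath N m j s (fwd f) :=
    fun j => continuous_immDeath m j (fwd_eq_zero hN)
  rw [key, key, neg_sub_neg, abs_sub_comm, ← intervalIntegral.integral_sub
    ((hc _).intervalIntegrable _ _) ((hc _).intervalIntegrable _ _)]
  simp only [immDeath_succ_sub]
  exact abs_integral_immDeath_le hm j (fwd_eq_zero hN) hf

/-! ### The perturbation of the Poisson Stein operator -/

/-- `∑ q (-q) ^ m u (j + m)` with `q = x / (1 - x)`. -/
noncomputable def geomSum (x : ℝ) (u : ℕ → ℝ) (j : ℕ) : ℝ :=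
  x / (1 - x) * ∑' m : ℕ, (-(x / (1 - x))) ^ m * u (j + m)

section
variable {x : ℝ} (h0 : 0 ≤ x) (h1 : x < 1 / 3)
include h0 h1

/-- The value is `q / (1 - q)`; this is where the weights with `1 - 2 x` come from. -/
theorem hasSum_odds : HasSum (fun m : ℕ => x / (1 - x) * (x / (1 - x)) ^ m) (x / (1 - 2 * x)) := by
  obtain ⟨hq0, -, hq2⟩ := odds_bounds h0 h1
  have h := (hasSum_geometric_of_lt_one hq0 (by linarith)).mul_left (x / (1 - x))
  convert! h using 1
  have e1 : 1 - x ≠ 0 := by linarith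
  have e2 : 1 - 2 * x ≠ 0 := by linarith
  have e3 : 1 - x / (1 - x) = (1 - 2 * x) / (1 - x) := by field_simp; ring
  rw [e3]
  field_simp

theorem summable_geom_mul {u : ℕ → ℝ} {C : ℝ} (hu : ∀ k, |u k| ≤ C) (j : ℕ) :
    Summable fun m : ℕ => (-(x / (1 - x))) ^ m * u (j + m) := by
  obtain ⟨hq0, -, hq2⟩ := odds_bounds h0 h1
  refine Summable.of_norm_bounded
    ((summable_geometric_of_lt_one hq0 (by linarith)).mul_right C) fun m => ?_
  rw [norm_mul, norm_pow, norm_neg, Real.norm_eq_abs, Real.norm_eq_abs, abs_of_nonneg hq0]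
  exact mul_le_mul_of_nonneg_left (hu _) (pow_nonneg hq0 m)

/-- `geomSum` inverts `1 + q S`, with `S` the shift, applied to `q u`. Multiplied by `1 - x` this
reads `(1 - x) g(j) + x g(j + 1) = x u(j)`. -/
theorem geomSum_add {u : ℕ → ℝ} {C : ℝ} (hu : ∀ k, |u k| ≤ C) (j : ℕ) :
    geomSum x u j + x / (1 - x) * geomSum x u (j + 1) = x / (1 - x) * u j := by
  have e : ∀ m : ℕ, (-(x / (1 - x))) ^ (m + 1) * u (j + (m + 1)) =
      -(x / (1 - x)) * ((-(x / (1 - x))) ^ m * u (j + 1 + m)) := fun m => by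
    rw [show j + (m + 1) = j + 1 + m by ring, pow_succ]
    ring
  unfold geomSum
  rw [(summable_geom_mul h0 h1 hu j).tsum_eq_zero_add]
  simp only [e]
  rw [tsum_mul_left, pow_zero, add_zero]
  ring

theorem abs_geomSum_le_tsum {u : ℕ → ℝ} {C : ℝ} (hu : ∀ k, |u k| ≤ C) (j : ℕ) :
    (Summable fun m : ℕ => x / (1 - x) * (x / (1 - x)) ^ m * |u (j + m)|) ∧
    |geomSum x u j| ≤ ∑' m : ℕ, x / (1 - x) * (x / (1 - x)) ^ m * |u (j + m)| := by
  obtain ⟨hq0, -, hq2⟩ := odds_bounds h0 h1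
  have hs := (summable_geom_mul h0 h1 hu j).norm
  have e : ∀ m, ‖(-(x / (1 - x))) ^ m * u (j + m)‖ = (x / (1 - x)) ^ m * |u (j + m)| := fun m => by
    rw [norm_mul, norm_pow, norm_neg, Real.norm_eq_abs, Real.norm_eq_abs, abs_of_nonneg hq0]
  have hn := norm_tsum_le_tsum_norm hs
  simp only [e] at hs hn
  simp only [mul_assoc]
  refine ⟨hs.mul_left _, ?_⟩
  rw [tsum_mul_left, geomSum, abs_mul, abs_of_nonneg hq0]
  exact mul_le_mul_of_nonneg_left hn hq0

theorem abs_geomSum_le {u : ℕ → ℝ} {C : ℝ} (hu : ∀ k, |u k| ≤ C) (j : ℕ) :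
    |geomSum x u j| ≤ x / (1 - 2 * x) * C := by
  obtain ⟨hq0, -, hq2⟩ := odds_bounds h0 h1
  obtain ⟨hs, hle⟩ := abs_geomSum_le_tsum h0 h1 hu j
  refine hle.trans ?_
  refine hasSum_le (fun m => ?_) hs.hasSum ((hasSum_odds h0 h1).mul_right C)
  exact mul_le_mul_of_nonneg_left (hu _) (by positivity)

theorem sum_abs_geomSum_le {u : ℕ → ℝ} {S : ℝ}
    (hS : ∀ N, ∑ k ∈ Finset.range N, |u k| ≤ S) (J : ℕ) :
    ∑ j ∈ Finset.range J, |geomSum x u j| ≤ x / (1 - 2 * x) * S := by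
  obtain ⟨hq0, -, hq2⟩ := odds_bounds h0 h1
  have hu : ∀ k, |u k| ≤ S := fun k =>
    (Finset.single_le_sum (f := fun k => |u k|) (fun _ _ => abs_nonneg _)
      (Finset.self_mem_range_succ k)).trans (hS (k + 1))
  have h := fun j => abs_geomSum_le_tsum h0 h1 hu j
  refine (Finset.sum_le_sum fun j _ => (h j).2).trans ?_
  rw [← Summable.tsum_finsetSum fun j _ => (h j).1]
  refine hasSum_le (fun m => ?_) (summable_sum fun j _ => (h j).1).hasSum
    ((hasSum_odds h0 h1).mul_right S)
  rw [← Finset.mul_sum]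
  refine mul_le_mul_of_nonneg_left ?_ (by positivity)
  have h2 : ∑ j ∈ Finset.range J, |u (j + m)| ≤ ∑ j ∈ Finset.range (m + J), |u j| := by
    rw [Finset.sum_range_add]
    simp only [add_comm m]
    exact le_add_of_nonneg_left (Finset.sum_nonneg fun _ _ => abs_nonneg _)
  exact h2.trans (hS _)

theorem geomSum_fwd {u : ℕ → ℝ} {C : ℝ} (hu : ∀ k, |u k| ≤ C) (j : ℕ) :
    geomSum x (fwd u) j = geomSum x u (j + 1) - geomSum x u j := by
  have e : ∀ m : ℕ, (-(x / (1 - x))) ^ m * fwd u (j + m) =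
      (-(x / (1 - x))) ^ m * u (j + 1 + m) - (-(x / (1 - x))) ^ m * u (j + m) := fun m => by
    rw [fwd, show j + 1 + m = j + m + 1 by ring]
    ring
  unfold geomSum
  simp only [e]
  rw [(summable_geom_mul h0 h1 hu (j + 1)).tsum_sub (summable_geom_mul h0 h1 hu j)]
  ring

/-- A rearrangement of `geomSum_add` that trades `u` for its difference and gains a second factor
`x`. -/
theorem geomSum_sub_eq {u : ℕ → ℝ} {C : ℝ} (hu : ∀ k, |u k| ≤ C) (j : ℕ) :
    geomSum x u j - x * u j = -(x * geomSum x (fwd u) j) := by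
  have h := geomSum_add h0 h1 hu j
  have e1 : 1 - x ≠ 0 := by linarith
  rw [geomSum_fwd h0 h1 hu]
  field_simp at h
  linear_combination h

theorem hasSum_factorCoeff_mul {u : ℕ → ℝ} {C : ℝ} (hu : ∀ k, |u k| ≤ C) (j : ℕ) :
    HasSum (fun l => factorCoeff x l * u (l + j)) (geomSum x u j - x * u j) := by
  have h2 := (summable_geom_mul h0 h1 hu j).hasSum.mul_left (x / (1 - x))
  have h3 : HasSum (fun l : ℕ => if l = 0 then x * u j else 0) (x * u j) := by
    simpa using hasSum_ite_eq (0 : ℕ) (x * u j)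
  convert! h2.sub h3 using 1
  funext l
  unfold factorCoeff
  rw [add_comm l j]
  by_cases hl : l = 0
  · subst hl
    simp
    ring
  · simp only [if_neg hl]
    ring

end

theorem summable_weight {p : ℕ → ℝ} (h1 : ∀ i, p i < 1 / 3) (hs : Summable fun i => p i ^ 2) :
    Summable fun i => p i ^ 2 / (1 - 2 * p i) ^ 2 := by
  refine Summable.of_nonneg_of_le (fun i => by positivity) (fun i => ?_) (hs.mul_left 9)
  have h : 1 / 3 ≤ 1 - 2 * p i := by linarith [h1 i]
  rw [div_le_iff₀ (by positivity)]
  nlinarith [mul_nonneg (sq_nonneg (p i)) (sub_nonneg.mpr h), sq_nonneg (p i)]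

theorem abs_tsum_le {f : ℕ → ℝ} (hf : Summable fun i => |f i|) : |∑' i, f i| ≤ ∑' i, |f i| := by
  have h := norm_tsum_le_tsum_norm (f := f) (by simpa only [Real.norm_eq_abs] using hf)
  simpa only [Real.norm_eq_abs] using h

/-- The perturbation of the Poisson Stein operator, acting on shifted functions. -/
noncomputable def pert (p : ℕ → ℝ) (u : ℕ → ℝ) (j : ℕ) : ℝ :=
  ∑' i, (geomSum (p i) u j - p i * u j)

section
variable {p : ℕ → ℝ} (h0 : ∀ i, 0 ≤ p i) (h1 : ∀ i, p i < 1 / 3)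
  (hs : Summable fun i => p i ^ 2)
include h0 h1

/-- The argument yields `p_i^2 / (1 - 2 p_i)`; enlarging it by another factor `1 / (1 - 2 p_i)`
gives the weight in `theta`. -/
theorem mul_div_le_weight (i : ℕ) :
    p i * (p i / (1 - 2 * p i)) ≤ p i ^ 2 / (1 - 2 * p i) ^ 2 := by
  have ha := h0 i
  have hb := h1 i
  have h : 0 < 1 - 2 * p i := by linarith
  rw [← mul_div_assoc, ← sq]
  refine div_le_div_of_nonneg_left (by positivity) (by positivity) ?_
  nlinarith

theorem abs_geomSum_sub_le {u : ℕ → ℝ} {C L : ℝ} (hu : ∀ k, |u k| ≤ C)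
    (hd : ∀ k, |fwd u k| ≤ L) (i j : ℕ) :
    |geomSum (p i) u j - p i * u j| ≤ p i ^ 2 / (1 - 2 * p i) ^ 2 * L := by
  have hL : 0 ≤ L := (abs_nonneg _).trans (hd 0)
  rw [geomSum_sub_eq (h0 i) (h1 i) hu, abs_neg, abs_mul, abs_of_nonneg (h0 i)]
  calc p i * |geomSum (p i) (fwd u) j| ≤ p i * (p i / (1 - 2 * p i) * L) :=
        mul_le_mul_of_nonneg_left (abs_geomSum_le (h0 i) (h1 i) hd j) (h0 i)
    _ = p i * (p i / (1 - 2 * p i)) * L := by ring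
    _ ≤ _ := mul_le_mul_of_nonneg_right (mul_div_le_weight h0 h1 i) hL

include hs

theorem summable_pert {u : ℕ → ℝ} {C L : ℝ} (hu : ∀ k, |u k| ≤ C)
    (hd : ∀ k, |fwd u k| ≤ L) (j : ℕ) :
    Summable fun i => |geomSum (p i) u j - p i * u j| :=
  Summable.of_nonneg_of_le (fun _ => abs_nonneg _)
    (fun i => abs_geomSum_sub_le h0 h1 hu hd i j) ((summable_weight h1 hs).mul_right L)

theorem abs_pert_le {u : ℕ → ℝ} {C L : ℝ} (hu : ∀ k, |u k| ≤ C)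
    (hd : ∀ k, |fwd u k| ≤ L) (j : ℕ) :
    |pert p u j| ≤ (∑' i, p i ^ 2 / (1 - 2 * p i) ^ 2) * L := by
  refine (abs_tsum_le (summable_pert h0 h1 hs hu hd j)).trans ?_
  rw [← tsum_mul_right]
  exact Summable.tsum_le_tsum (fun i => abs_geomSum_sub_le h0 h1 hu hd i j)
    (summable_pert h0 h1 hs hu hd j) ((summable_weight h1 hs).mul_right L)

/-- The `ℓ¹` counterpart of `abs_pert_le`, needed for the point metric: `geomSum` is bounded on `ℓ¹`
with the same constant as on bounded sequences. -/
theorem sum_abs_pert_le {u : ℕ → ℝ} {C S : ℝ} (hu : ∀ k, |u k| ≤ C)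
    (hS : ∀ N, ∑ k ∈ Finset.range N, |fwd u k| ≤ S) (J : ℕ) :
    ∑ j ∈ Finset.range J, |pert p u j| ≤ (∑' i, p i ^ 2 / (1 - 2 * p i) ^ 2) * S := by
  have hS0 : 0 ≤ S := by simpa using hS 0
  have hd : ∀ k, |fwd u k| ≤ S := fun k =>
    (Finset.single_le_sum (f := fun k => |fwd u k|) (fun _ _ => abs_nonneg _)
      (Finset.self_mem_range_succ k)).trans (hS (k + 1))
  have hsum := fun j => summable_pert h0 h1 hs hu hd j
  have hle : ∀ j, |pert p u j| ≤ ∑' i, |geomSum (p i) u j - p i * u j| :=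
    fun j => abs_tsum_le (hsum j)
  refine (Finset.sum_le_sum fun j _ => hle j).trans ?_
  rw [← Summable.tsum_finsetSum fun j _ => hsum j, ← tsum_mul_right]
  refine Summable.tsum_le_tsum (fun i => ?_) (summable_sum fun j _ => hsum j)
    ((summable_weight h1 hs).mul_right S)
  have e : ∀ j, |geomSum (p i) u j - p i * u j| = p i * |geomSum (p i) (fwd u) j| := fun j => by
    rw [geomSum_sub_eq (h0 i) (h1 i) hu, abs_neg, abs_mul, abs_of_nonneg (h0 i)]
  simp only [e]
  rw [← Finset.mul_sum]
  calc _ ≤ p i * (p i / (1 - 2 * p i) * S) :=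
        mul_le_mul_of_nonneg_left (sum_abs_geomSum_le (h0 i) (h1 i) hS J) (h0 i)
    _ = p i * (p i / (1 - 2 * p i)) * S := by ring
    _ ≤ _ := mul_le_mul_of_nonneg_right (mul_div_le_weight h0 h1 i) hS0

theorem pert_eq_sum_add {u : ℕ → ℝ} {C L : ℝ} (hu : ∀ k, |u k| ≤ C)
    (hd : ∀ k, |fwd u k| ≤ L) (n j : ℕ) :
    pert p u j = ∑ i ∈ Finset.range n, (geomSum (p i) u j - p i * u j) +
      pert (fun i => p (n + i)) u j := by
  have h := (summable_pert h0 h1 hs hu hd j).of_abs.sum_add_tsum_nat_add n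
  rw [pert, ← h]
  simp only [pert, add_comm n]

/-- Summing over powers before indices turns the coefficients of the logarithmic derivative into
`geomSum` operators, one for each index. -/
theorem tsum_approxCoeff_mul {u : ℕ → ℝ} {C : ℝ} (hu : ∀ k, |u k| ≤ C) (m : ℝ) (j : ℕ) :
    ∑' l, approxCoeff p m l * u (l + j) = m * u j + pert p u j := by
  have hC : 0 ≤ C := (abs_nonneg _).trans (hu 0)
  have hsum : Summable fun x : ℕ × ℕ => factorCoeff (p x.1) x.2 * u (x.2 + j) := by
    refine Summable.of_norm_bounded ((summable_abs_factorCoeff h0 h1 hs).mul_right C) fun x => ?_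
    rw [norm_mul]
    exact mul_le_mul_of_nonneg_left (hu _) (abs_nonneg _)
  have hbp : HasSum (fun l => bpCoeff p l * u (l + j)) (pert p u j) := by
    have h := hsum.prod_symm.hasSum.prod_fiberwise fun l =>
      (hsum.prod_symm.prod_factor l).hasSum
    have e : ∀ l, ∑' i, factorCoeff (p i) l * u (l + j) = bpCoeff p l * u (l + j) := fun l => by
      rw [tsum_mul_right, bpCoeff]
    have e2 : ∑' x : ℕ × ℕ, factorCoeff (p x.swap.1) x.swap.2 * u (x.swap.2 + j) =
        pert p u j := by
      have h3 := (Equiv.prodComm ℕ ℕ).tsum_eq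
        fun x : ℕ × ℕ => factorCoeff (p x.1) x.2 * u (x.2 + j)
      simp only [Equiv.prodComm_apply] at h3
      rw [h3, hsum.tsum_prod, pert]
      exact tsum_congr fun i => (hasSum_factorCoeff_mul (h0 i) (h1 i) hu j).tsum_eq
    rw [e2] at h
    simpa only [Prod.swap_prod_mk, Prod.fst_swap, Prod.snd_swap, e] using h
  have h3 : HasSum (fun l : ℕ => if l = 0 then m * u j else 0) (m * u j) := by
    simpa using hasSum_ite_eq (0 : ℕ) (m * u j)
  rw [← (h3.add hbp).tsum_eq]
  refine tsum_congr fun l => ?_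
  unfold approxCoeff
  by_cases hl : l = 0
  · subst hl
    simp
    ring
  · simp [hl]

end

/-! ### The Stein identity for `Po(λ) * BP` -/

theorem hasSum_sum_antidiagonal {F : ℕ × ℕ → ℝ} (hF : Summable F) :
    HasSum (fun k => ∑ x ∈ Finset.HasAntidiagonal.antidiagonal k, F x) (∑' x, F x) := by
  have h : HasSum (F ∘ Finset.HasAntidiagonal.sigmaAntidiagonalEquivProd) (∑' x, F x) :=
    Finset.HasAntidiagonal.sigmaAntidiagonalEquivProd.hasSum_iff.mpr hF.hasSum
  have h2 := h.sigma fun k => hasSum_fintype _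
  convert! h2 using 1
  funext k
  exact (Finset.sum_coe_sort (Finset.HasAntidiagonal.antidiagonal k) F).symm

section
variable {p : ℕ → ℝ} (h0 : ∀ i, 0 ≤ p i) (h1 : ∀ i, p i < 1 / 3)
  (hs : Summable fun i => p i ^ 2)
include h0 h1 hs

theorem summable_abs_conv {m : ℝ} (hm : 0 ≤ m) :
    Summable fun k => |conv (poissonMass m) (bp p) k| :=
  (isSignedCompoundPoisson_conv h0 h1 hs hm).1

/-- The Stein identity for `Po(m) * BP`. -/
theorem stein_identity {m : ℝ} (hm : 0 ≤ m) {u : ℕ → ℝ} {C : ℝ} (hu : ∀ k, |u k| ≤ C) :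
    HasSum (fun k : ℕ => ((k : ℝ) + 1) * conv (poissonMass m) (bp p) (k + 1) * u k)
      (∑' j, conv (poissonMass m) (bp p) j * (m * u j + pert p u j)) := by
  have hC : 0 ≤ C := (abs_nonneg _).trans (hu 0)
  have ha := summable_abs_approxCoeff h0 h1 hs m
  have hb := summable_abs_conv h0 h1 hs hm
  set a := approxCoeff p m with hadef
  set b := conv (poissonMass m) (bp p) with hbdef
  have hF : Summable fun x : ℕ × ℕ => a x.1 * b x.2 * u (x.1 + x.2) := by
    refine Summable.of_norm_bounded ((summable_mul_prod (u := fun l => |a l|)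
      (v := fun l => |b l|) ha hb).mul_right C) fun x => ?_
    rw [norm_mul, norm_mul]
    exact mul_le_mul_of_nonneg_left (hu _) (mul_nonneg (norm_nonneg _) (norm_nonneg _))
  -- The double sum of `a l * b j * u (l + j)` gives the left side when grouped by `l + j`, through
  -- the recursion for `b`, and the right side when grouped by `j`.
  have h := hasSum_sum_antidiagonal hF
  have e : ∀ k, ∑ x ∈ Finset.HasAntidiagonal.antidiagonal k, a x.1 * b x.2 * u (x.1 + x.2) =
      ((k : ℝ) + 1) * b (k + 1) * u k := fun k => by
    rw [hbdef, succ_mul_conv h0 h1 hs hm, Finset.sum_mul]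
    refine Finset.sum_congr rfl fun x hx => ?_
    rw [Finset.HasAntidiagonal.mem_antidiagonal.mp hx]
  simp only [e] at h
  convert! h using 1
  have h3 := (Equiv.prodComm ℕ ℕ).tsum_eq fun x : ℕ × ℕ => a x.1 * b x.2 * u (x.1 + x.2)
  have h4 := Summable.tsum_prod ((Equiv.prodComm ℕ ℕ).summable_iff.mpr hF)
  simp only [Function.comp_apply] at h4
  rw [← h3, h4]
  refine tsum_congr fun j => ?_
  rw [← tsum_approxCoeff_mul h0 h1 hs hu m j, ← tsum_mul_left]
  refine tsum_congr fun l => ?_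
  simp only [Equiv.prodComm_apply, Prod.swap_prod_mk]
  ring

end

/-! ### The Stein functional of `W` -/

theorem W_eq_Wminus_add {Ω : Type*} {I : ℕ → Ω → ℕ} {n i : ℕ} (hi : i < n) (ω : Ω) :
    W I n ω = Wminus I n i ω + I i ω :=
  (Finset.sum_erase_add _ _ (Finset.mem_range.mpr hi)).symm

section
variable {Ω : Type*} [MeasurableSpace Ω] {μ : Measure Ω}

theorem integrable_comp_of_bounded [IsFiniteMeasure μ] {Y : Ω → ℕ} (hY : AEMeasurable Y μ)
    {h : ℕ → ℝ} {C : ℝ} (hh : ∀ k, |h k| ≤ C) : Integrable (fun ω => h (Y ω)) μ :=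
  Integrable.of_bound (measurable_from_nat.comp_aemeasurable hY).aestronglyMeasurable C
    (Filter.Eventually.of_forall fun _ => hh _)

theorem integrable_comp_of_ae_le [IsFiniteMeasure μ] {Y : Ω → ℕ} (hY : AEMeasurable Y μ) {B : ℕ}
    (hB : ∀ᵐ ω ∂μ, Y ω ≤ B) (h : ℕ → ℝ) : Integrable (fun ω => h (Y ω)) μ := by
  refine Integrable.of_bound (measurable_from_nat.comp_aemeasurable hY).aestronglyMeasurable
    (∑ k ∈ Finset.range (B + 1), |h k|) ?_
  filter_upwards [hB] with ω hω
  exact Finset.single_le_sum (f := fun k => |h k|) (fun _ _ => abs_nonneg _)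
    (Finset.mem_range.mpr (Nat.lt_succ_of_le hω))

/-- Almost surely `X` is the indicator of the conditioning event, and conditioning divides by its
probability `x`. -/
theorem integral_mul_comp_eq [IsProbabilityMeasure μ] {X Y Z : Ω → ℕ} (hX : Measurable X)
    (hX01 : ∀ᵐ ω ∂μ, X ω = 0 ∨ X ω = 1) {x : ℝ} (hx : μ.real {ω | X ω = 1} = x) (hx0 : 0 < x)
    (hZ : IdentDistrib Z Y μ (cond μ {ω | X ω = 1})) (h : ℕ → ℝ) :
    ∫ ω, (X ω : ℝ) * h (Y ω) ∂μ = x * ∫ ω, h (Z ω) ∂μ := by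
  have hs : MeasurableSet {ω | X ω = 1} := hX (measurableSet_singleton 1)
  have h1 : ∫ ω, h (Z ω) ∂μ = ∫ ω, h (Y ω) ∂(cond μ {ω | X ω = 1}) :=
    (hZ.comp (u := h) measurable_from_nat).integral_eq
  rw [h1, ProbabilityTheory.cond, integral_smul_measure, ← integral_indicator hs, smul_eq_mul,
    ENNReal.toReal_inv, ← measureReal_def, hx, ← mul_assoc, mul_inv_cancel₀ hx0.ne', one_mul]
  refine integral_congr_ae ?_
  filter_upwards [hX01] with ω hω
  rcases hω with hω | hω
  · simp [Set.indicator, hω]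
  · simp [Set.indicator, hω]

theorem abs_sub_le_mul_of_fwd {v : ℕ → ℝ} {K : ℝ} (hv : ∀ k, |fwd v k| ≤ K) (a b : ℕ) :
    |v a - v b| ≤ K * |(a : ℝ) - b| := by
  have key : ∀ b d : ℕ, |v (b + d) - v b| ≤ K * d := by
    intro b d
    induction d with
    | zero => simp
    | succ d ih =>
      have h : v (b + (d + 1)) - v b = fwd v (b + d) + (v (b + d) - v b) := by
        rw [fwd, add_assoc]; ring
      rw [h]
      push_cast
      have := abs_add_le (fwd v (b + d)) (v (b + d) - v b)
      linarith [hv (b + d)]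
  rcases le_total b a with h | h
  · obtain ⟨d, rfl⟩ := Nat.exists_eq_add_of_le h
    have e : ((b + d : ℕ) : ℝ) - b = d := by push_cast; ring
    rw [e, Nat.abs_cast]
    exact key b d
  · obtain ⟨d, rfl⟩ := Nat.exists_eq_add_of_le h
    have e : (a : ℝ) - ((a + d : ℕ) : ℝ) = -d := by push_cast; ring
    rw [e, abs_neg, Nat.abs_cast, abs_sub_comm]
    exact key a d

theorem abs_integral_sub_le_mul [IsFiniteMeasure μ] {Y Z : Ω → ℕ} (hY : AEMeasurable Y μ)
    (hZ : AEMeasurable Z μ) {B : ℕ} (hYB : ∀ᵐ ω ∂μ, Y ω ≤ B) (hZB : ∀ᵐ ω ∂μ, Z ω ≤ B)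
    {v : ℕ → ℝ} {K : ℝ} (hv : ∀ k, |fwd v k| ≤ K) :
    |∫ ω, v (Y ω) ∂μ - ∫ ω, v (Z ω) ∂μ| ≤ K * ∫ ω, |(Z ω : ℝ) - (Y ω : ℝ)| ∂μ := by
  have hYi := integrable_comp_of_ae_le hY hYB
  have hZi := integrable_comp_of_ae_le hZ hZB
  rw [← integral_sub (hYi v) (hZi v), ← integral_const_mul]
  refine (abs_integral_le_integral_abs).trans (integral_mono ((hYi v).sub (hZi v)).abs
    (((hZi (fun k => (k : ℝ))).sub (hYi (fun k => (k : ℝ)))).abs.const_mul K) fun ω => ?_)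
  have := abs_sub_le_mul_of_fwd hv (Y ω) (Z ω)
  rwa [abs_sub_comm (Y ω : ℝ)] at this

/-- With `v = geomSum x u`, the first integral is `E v(Y) + x E Δv(Z)` and the second is `(1 - x) E
v(Z) + x E v(Z + 1)`. All but `E v(Y) - E v(Z)` cancels, and `v` is Lipschitz. -/
theorem abs_stein_step_le [IsProbabilityMeasure μ] {X Y Z : Ω → ℕ} (hX : Measurable X)
    (hX01 : ∀ᵐ ω ∂μ, X ω = 0 ∨ X ω = 1) (hY : Measurable Y) {B : ℕ} (hYB : ∀ᵐ ω ∂μ, Y ω ≤ B)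
    {x : ℝ} (hx : μ.real {ω | X ω = 1} = x) (h1 : x < 1 / 3)
    (hZ : 0 < x → IdentDistrib Z Y μ (cond μ {ω | X ω = 1}))
    {u : ℕ → ℝ} {C L : ℝ} (hu : ∀ k, |u k| ≤ C) (hd : ∀ k, |fwd u k| ≤ L) :
    |∫ ω, geomSum x u (Y ω + X ω) ∂μ - ∫ ω, (X ω : ℝ) * u (Y ω) ∂μ| ≤
      x / (1 - 2 * x) * L * ∫ ω, |(Z ω : ℝ) - (Y ω : ℝ)| ∂μ := by
  have h0 : 0 ≤ x := hx ▸ measureReal_nonneg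
  -- No coupling is assumed for `x = 0`; then `X = 0` almost surely and both integrals vanish.
  rcases h0.eq_or_lt with rfl | hpos
  · have hz : ∀ᵐ ω ∂μ, X ω = 0 := by
      rw [measureReal_eq_zero_iff] at hx
      have hne : ∀ᵐ ω ∂μ, ¬ X ω = 1 := by
        rw [ae_iff]
        simpa using hx
      filter_upwards [hX01, hne] with ω h2 h3
      exact h2.resolve_right h3
    have e : ∫ ω, (X ω : ℝ) * u (Y ω) ∂μ = 0 := by
      rw [← integral_zero Ω ℝ (μ := μ)]
      refine integral_congr_ae ?_
      filter_upwards [hz] with ω hω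
      simp [hω]
    rw [e]
    simp [geomSum]
  · have hZ' := hZ hpos
    set v := geomSum x u with hv
    have hvb : ∀ k, |v k| ≤ x / (1 - 2 * x) * C := abs_geomSum_le h0 h1 hu
    have hvd : ∀ k, |fwd v k| ≤ x / (1 - 2 * x) * L := fun k => by
      rw [fwd, hv, ← geomSum_fwd h0 h1 hu]
      exact abs_geomSum_le h0 h1 hd k
    have hZm : AEMeasurable Z μ := hZ'.aemeasurable_fst
    have hZB : ∀ᵐ ω ∂μ, Z ω ≤ B :=
      hZ'.symm.ae_snd (p := fun k => k ≤ B) (measurableSet_Iic)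
        (cond_absolutelyContinuous.ae_le hYB)
    have i1 := integrable_comp_of_bounded (μ := μ) hY.aemeasurable hvb
    have i2 := integrable_comp_of_bounded hZm hvb
    have i3 := integrable_comp_of_bounded (h := fun k => v (k + 1)) hZm fun k => hvb _
    have e1 : ∫ ω, v (Y ω + X ω) ∂μ = ∫ ω, v (Y ω) ∂μ + ∫ ω, (X ω : ℝ) * fwd v (Y ω) ∂μ := by
      have hae : (fun ω => (X ω : ℝ) * fwd v (Y ω)) =ᵐ[μ] fun ω => v (Y ω + X ω) - v (Y ω) := by
        filter_upwards [hX01] with ω hω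
        rcases hω with hω | hω <;> simp [hω, fwd]
      rw [integral_congr_ae hae, integral_sub _ i1]
      · ring
      · exact integrable_comp_of_bounded (hY.add hX).aemeasurable hvb
    have e2 : ∫ ω, fwd v (Z ω) ∂μ = ∫ ω, v (Z ω + 1) ∂μ - ∫ ω, v (Z ω) ∂μ :=
      integral_sub i3 i2
    have hq : x / (1 - x) ≠ 0 := (div_pos hpos (by linarith)).ne'
    have e3 : x * ∫ ω, u (Z ω) ∂μ = (1 - x) * ∫ ω, v (Z ω) ∂μ + x * ∫ ω, v (Z ω + 1) ∂μ := by
      rw [← integral_const_mul, ← integral_const_mul, ← integral_const_mul,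
        ← integral_add (i2.const_mul _) (i3.const_mul _)]
      refine integral_congr_ae (Filter.Eventually.of_forall fun ω => ?_)
      have h := geomSum_add h0 h1 hu (Z ω)
      rw [← hv] at h
      have e1 : 1 - x ≠ 0 := by linarith
      field_simp at h
      simp only
      linear_combination -h
    rw [e1, integral_mul_comp_eq hX hX01 hx hpos hZ', integral_mul_comp_eq hX hX01 hx hpos hZ',
      e2, e3]
    have e4 : ∫ ω, v (Y ω) ∂μ + x * (∫ ω, v (Z ω + 1) ∂μ - ∫ ω, v (Z ω) ∂μ) -
        ((1 - x) * ∫ ω, v (Z ω) ∂μ + x * ∫ ω, v (Z ω + 1) ∂μ) =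
        ∫ ω, v (Y ω) ∂μ - ∫ ω, v (Z ω) ∂μ := by ring
    rw [e4]
    exact abs_integral_sub_le_mul hY.aemeasurable hZm hYB hZB hvd

section
variable {n : ℕ} {p : ℕ → ℝ} {I Wt : ℕ → Ω → ℕ}

theorem measurable_W (hI : ∀ i, Measurable (I i)) : Measurable (W I n) := by
  unfold W
  exact Finset.measurable_fun_sum _ fun i _ => hI i

theorem measurable_Wminus (hI : ∀ i, Measurable (I i)) (i : ℕ) : Measurable (Wminus I n i) := by
  unfold Wminus
  exact Finset.measurable_fun_sum _ fun i _ => hI i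

theorem ae_W_le (h01 : ∀ i, ∀ᵐ ω ∂μ, I i ω = 0 ∨ I i ω = 1) : ∀ᵐ ω ∂μ, W I n ω ≤ n := by
  filter_upwards [ae_all_iff.mpr h01] with ω hω
  calc W I n ω ≤ ∑ _j ∈ Finset.range n, 1 := Finset.sum_le_sum fun j _ => by
        rcases hω j with h | h <;> omega
    _ = n := by simp

theorem ae_Wminus_le (h01 : ∀ i, ∀ᵐ ω ∂μ, I i ω = 0 ∨ I i ω = 1) {i : ℕ} (hi : i < n) :
    ∀ᵐ ω ∂μ, Wminus I n i ω ≤ n := by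
  filter_upwards [ae_W_le h01] with ω hω
  rw [W_eq_Wminus_add hi] at hω
  omega

/-- A summand survives only when `I i = 1`, and then `W - 1` equals `Wminus I n i`. When `W = 0` the
truncated subtraction is multiplied by 0. -/
theorem ae_W_mul_eq (h01 : ∀ i, ∀ᵐ ω ∂μ, I i ω = 0 ∨ I i ω = 1) (u : ℕ → ℝ) :
    ∀ᵐ ω ∂μ, (W I n ω : ℝ) * u (W I n ω - 1) =
      ∑ i ∈ Finset.range n, (I i ω : ℝ) * u (Wminus I n i ω) := by
  filter_upwards [ae_all_iff.mpr h01] with ω hω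
  have e : (W I n ω : ℝ) = ∑ i ∈ Finset.range n, (I i ω : ℝ) := by
    unfold W
    push_cast
    rfl
  rw [e, Finset.sum_mul]
  refine Finset.sum_congr rfl fun i hi => ?_
  rw [W_eq_Wminus_add (Finset.mem_range.mp hi) ω]
  rcases hω i with h | h <;> simp [h]

/-- The part of the Stein functional of `W` coming from the first `n` variables is controlled by
`eta`. -/
theorem abs_stein_expectation_le [IsProbabilityMeasure μ] (hI : ∀ i, Measurable (I i))
    (h01 : ∀ i, ∀ᵐ ω ∂μ, I i ω = 0 ∨ I i ω = 1) (hprob : ∀ i, μ.real {ω | I i ω = 1} = p i)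
    (hWt : ∀ i < n, 0 < p i → IdentDistrib (Wt i) (Wminus I n i) μ (cond μ {ω | I i ω = 1}))
    (h1 : ∀ i, p i < 1 / 3) (hs : Summable fun i => p i ^ 2)
    {u : ℕ → ℝ} {C L : ℝ} (hu : ∀ k, |u k| ≤ C) (hd : ∀ k, |fwd u k| ≤ L) :
    |∫ ω, (lam p n * u (W I n ω) + pert p u (W I n ω)) ∂μ -
        ∫ ω, (W I n ω : ℝ) * u (W I n ω - 1) ∂μ -
        ∫ ω, pert (fun i => p (n + i)) u (W I n ω) ∂μ| ≤ L * eta μ p I Wt n := by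
  have h0 : ∀ i, 0 ≤ p i := fun i => hprob i ▸ measureReal_nonneg
  have hW := measurable_W (n := n) hI
  have hg : ∀ i, ∀ k, |geomSum (p i) u k| ≤ p i / (1 - 2 * p i) * C :=
    fun i => abs_geomSum_le (h0 i) (h1 i) hu
  have hgi : ∀ i, Integrable (fun ω => geomSum (p i) u (W I n ω)) μ :=
    fun i => integrable_comp_of_bounded hW.aemeasurable (hg i)
  have hti : Integrable (fun ω => pert (fun i => p (n + i)) u (W I n ω)) μ :=
    integrable_comp_of_ae_le hW.aemeasurable (ae_W_le h01) _
  have e1 : ∀ k, lam p n * u k + pert p u k =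
      ∑ i ∈ Finset.range n, geomSum (p i) u k + pert (fun i => p (n + i)) u k := fun k => by
    rw [pert_eq_sum_add h0 h1 hs hu hd n k, Finset.sum_sub_distrib, ← Finset.sum_mul, lam]
    ring
  have hXi : ∀ i ∈ Finset.range n,
      Integrable (fun ω => (I i ω : ℝ) * u (Wminus I n i ω)) μ := fun i _ => by
    refine Integrable.of_bound (((measurable_from_nat.comp (hI i)).mul
      (measurable_from_nat.comp (measurable_Wminus hI i))).aestronglyMeasurable) C ?_
    filter_upwards [h01 i] with ω hω
    rw [norm_mul]
    rcases hω with h | h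
    · simpa [h] using (abs_nonneg _).trans (hu 0)
    · simpa [h] using hu _
  simp only [e1]
  rw [integral_add (integrable_finsetSum _ fun i _ => hgi i) hti,
    integral_finsetSum _ fun i _ => hgi i, integral_congr_ae (ae_W_mul_eq h01 u),
    integral_finsetSum _ hXi, add_sub_right_comm, add_sub_cancel_right, ← Finset.sum_sub_distrib,
    eta, Finset.mul_sum]
  refine (Finset.abs_sum_le_sum_abs _ _).trans (Finset.sum_le_sum fun i hi => ?_)
  have hi' := Finset.mem_range.mp hi
  have h := abs_stein_step_le (hI i) (h01 i) (measurable_Wminus hI i) (ae_Wminus_le h01 hi')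
    (hprob i) (h1 i) (hWt i hi') hu hd
  simp only [W_eq_Wminus_add hi']
  refine h.trans_eq ?_
  ring

theorem hasSum_lawMass_mul [IsFiniteMeasure μ] (hI : ∀ i, Measurable (I i))
    (h01 : ∀ i, ∀ᵐ ω ∂μ, I i ω = 0 ∨ I i ω = 1) (h : ℕ → ℝ) :
    HasSum (fun k => lawMass μ (W I n) k * h k) (∫ ω, h (W I n ω) ∂μ) := by
  have hle := ae_W_le (n := n) h01
  have hm : ∀ k, MeasurableSet {ω | W I n ω = k} :=
    fun k => measurable_W hI (measurableSet_singleton k)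
  have hae : (fun ω => h (W I n ω)) =ᵐ[μ] fun ω => ∑ k ∈ Finset.range (n + 1),
      {ω | W I n ω = k}.indicator (fun _ => h k) ω := by
    filter_upwards [hle] with ω hω
    rw [Finset.sum_eq_single (W I n ω)]
    · simp
    · intro k _ hk
      simp [hk.symm]
    · intro hn
      exact absurd (Finset.mem_range.mpr (Nat.lt_succ_of_le hω)) hn
  rw [integral_congr_ae hae, integral_finsetSum _ fun k _ =>
    (integrable_const (h k)).indicator (hm k)]
  have e : ∀ k, ∫ ω, {ω | W I n ω = k}.indicator (fun _ => h k) ω ∂μ =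
      lawMass μ (W I n) k * h k := fun k => by
    rw [integral_indicator_const _ (hm k), smul_eq_mul, lawMass]
  simp only [e]
  refine hasSum_sum_of_ne_finset_zero fun k hk => ?_
  have hz : μ {ω | W I n ω = k} = 0 := by
    refine measure_mono_null (fun ω hω => ?_) (ae_iff.mp hle)
    simp only [Finset.mem_range, not_lt, Set.mem_ofPred_eq] at hk hω ⊢
    omega
  rw [lawMass, measureReal_def, hz, ENNReal.toReal_zero, zero_mul]

end

end

/-! ### Stein solutions for finitely supported functions and summation bounds -/

/-- The shifted solution of the Poisson Stein equation for `f` vanishing outside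
`{0, …, N - 1}`. -/
noncomputable def steinSol (m : ℝ) (N : ℕ) (f : ℕ → ℝ) (j : ℕ) : ℝ :=
  ∑ k ∈ Finset.range N, f k * steinPoint m k j

theorem poissonSum_eq {m : ℝ} (hm : 0 ≤ m) (N : ℕ) (f : ℕ → ℝ) :
    poissonSum N m f = ∑ k ∈ Finset.range N, f k * poissonMass m k :=
  Finset.sum_congr rfl fun k _ => by rw [poissonMass_eq hm, poissonTerm, mul_comm]

theorem sum_mul_indicator {N : ℕ} {f : ℕ → ℝ} (hN : ∀ k, N ≤ k → f k = 0) (j : ℕ) :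
    ∑ k ∈ Finset.range N, f k * (if k = j then 1 else 0) = f j := by
  simp only [mul_ite, mul_one, mul_zero, Finset.sum_ite_eq', Finset.mem_range]
  split_ifs with h
  · rfl
  · exact (hN j (not_lt.mp h)).symm

theorem steinSol_zero {m : ℝ} (hm : 0 < m) {N : ℕ} {f : ℕ → ℝ} (hN : ∀ k, N ≤ k → f k = 0) :
    m * steinSol m N f 0 = f 0 - poissonSum N m f := by
  rw [poissonSum_eq hm.le, ← sum_mul_indicator hN 0, ← Finset.sum_sub_distrib, steinSol,
    Finset.mul_sum]
  refine Finset.sum_congr rfl fun k _ => ?_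
  linear_combination f k * steinPoint_zero hm k

theorem steinSol_succ {m : ℝ} (hm : 0 < m) {N : ℕ} {f : ℕ → ℝ} (hN : ∀ k, N ≤ k → f k = 0)
    (j : ℕ) : m * steinSol m N f (j + 1) - ((j : ℝ) + 1) * steinSol m N f j =
      f (j + 1) - poissonSum N m f := by
  rw [poissonSum_eq hm.le, ← sum_mul_indicator hN (j + 1), ← Finset.sum_sub_distrib, steinSol,
    steinSol, Finset.mul_sum, Finset.mul_sum, ← Finset.sum_sub_distrib]
  refine Finset.sum_congr rfl fun k _ => ?_
  linear_combination f k * steinPoint_succ hm k j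

theorem exists_abs_steinSol_le {m : ℝ} (hm : 0 < m) (N : ℕ) (f : ℕ → ℝ) :
    ∃ C, ∀ j, |steinSol m N f j| ≤ C := by
  choose C hC using exists_abs_steinPoint_le hm
  refine ⟨∑ k ∈ Finset.range N, |f k| * C k, fun j => ?_⟩
  refine (Finset.abs_sum_le_sum_abs _ _).trans (Finset.sum_le_sum fun k _ => ?_)
  rw [abs_mul]
  exact mul_le_mul_of_nonneg_left (hC k j) (abs_nonneg _)

/-- The values of `f` are arbitrary in `[-1, 1]`, so the increments of the point solutions must be
summed in absolute value over `k`. -/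
theorem abs_fwd_steinSol_le {m : ℝ} (hm : 0 < m) (N : ℕ) {f : ℕ → ℝ} (hf : ∀ k, |f k| ≤ 1)
    (j : ℕ) : |fwd (steinSol m N f) j| ≤ 2 / m := by
  refine le_trans ?_ (abs_steinPoint_diff_le hm j N)
  rw [fwd, steinSol, steinSol, ← Finset.sum_sub_distrib]
  refine (Finset.abs_sum_le_sum_abs _ _).trans (Finset.sum_le_sum fun k _ => ?_)
  rw [← mul_sub, abs_mul]
  exact mul_le_of_le_one_left (abs_nonneg _) (hf k)

theorem summable_mul_of_bounded {a h : ℕ → ℝ} {H : ℝ} (ha : Summable fun k => |a k|)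
    (hh : ∀ k, |h k| ≤ H) : Summable fun k => a k * h k := by
  refine Summable.of_norm_bounded (ha.mul_right H) fun k => ?_
  rw [norm_mul]
  exact mul_le_mul_of_nonneg_left (hh k) (abs_nonneg _)

theorem abs_tsum_mul_le {a h : ℕ → ℝ} {H : ℝ} (ha : Summable fun k => |a k|)
    (hh : ∀ k, |h k| ≤ H) : |∑' k, a k * h k| ≤ (∑' k, |a k|) * H := by
  have hle : ∀ k, |a k * h k| ≤ |a k| * H := fun k => by
    rw [abs_mul]
    exact mul_le_mul_of_nonneg_left (hh k) (abs_nonneg _)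
  have hs : Summable fun k => |a k * h k| :=
    Summable.of_nonneg_of_le (fun _ => abs_nonneg _) hle (ha.mul_right H)
  refine (abs_tsum_le hs).trans ?_
  rw [← tsum_mul_right]
  exact Summable.tsum_le_tsum hle hs (ha.mul_right H)

theorem abs_tsum_mul_le_of_sum_le {a h : ℕ → ℝ} {A H : ℝ} (ha : ∀ k, |a k| ≤ A)
    (hh : ∀ J, ∑ k ∈ Finset.range J, |h k| ≤ H) : |∑' k, a k * h k| ≤ A * H := by
  have hA : 0 ≤ A := (abs_nonneg _).trans (ha 0)
  have hs : Summable fun k => |h k| :=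
    summable_of_sum_range_le (fun _ => abs_nonneg _) hh
  simp only [mul_comm (a _)]
  refine (abs_tsum_mul_le hs ha).trans ?_
  rw [mul_comm]
  exact mul_le_mul_of_nonneg_left
    (Real.tsum_le_of_sum_range_le (fun _ => abs_nonneg _) hh) hA

theorem tsum_weight_eq {p : ℕ → ℝ} {n : ℕ} (hlam : 0 < lam p n) :
    ∑' i, p i ^ 2 / (1 - 2 * p i) ^ 2 = lam p n * theta p n := by
  rw [theta, mul_div_cancel₀ _ hlam.ne']

theorem theta_nonneg {p : ℕ → ℝ} {n : ℕ} (hlam : 0 < lam p n) : 0 ≤ theta p n :=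
  div_nonneg (tsum_nonneg fun _ => by positivity) hlam.le

theorem summable_abs_bpApprox {p : ℕ → ℝ} {n : ℕ} (h0 : ∀ i, 0 ≤ p i) (h1 : ∀ i, p i < 1 / 3)
    (hs : Summable fun i => p i ^ 2) (hlam : 0 < lam p n) :
    Summable fun k => |bpApprox p n k| :=
  summable_abs_conv h0 h1 hs hlam.le

/-! ### The three distance bounds -/

section
variable {Ω : Type*} [MeasurableSpace Ω] {μ : Measure Ω} [IsProbabilityMeasure μ]
  {n : ℕ} {p : ℕ → ℝ} {I Wt : ℕ → Ω → ℕ}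
  (hI : ∀ i, Measurable (I i)) (h01 : ∀ i, ∀ᵐ ω ∂μ, I i ω = 0 ∨ I i ω = 1)
  (hprob : ∀ i, μ.real {ω | I i ω = 1} = p i)
  (hWt : ∀ i < n, 0 < p i → IdentDistrib (Wt i) (Wminus I n i) μ (cond μ {ω | I i ω = 1}))
  (h1 : ∀ i, p i < 1 / 3) (hs : Summable fun i => p i ^ 2) (hlam : 0 < lam p n)
include hI h01

theorem summable_abs_lawMass : Summable fun k => |lawMass μ (W I n) k| := by
  have h := (hasSum_lawMass_mul (n := n) hI h01 fun _ => 1).summable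
  simp only [mul_one] at h
  exact h.abs

theorem summable_nat_mul_lawMass : Summable fun k : ℕ => (k : ℝ) * |lawMass μ (W I n) k| := by
  have h := (hasSum_lawMass_mul (n := n) hI h01 fun k => k).summable.abs
  refine h.congr fun k => ?_
  rw [abs_mul, Nat.abs_cast, mul_comm]

theorem tsum_lawMass : ∑' k, lawMass μ (W I n) k = 1 := by
  have h := (hasSum_lawMass_mul (n := n) hI h01 fun _ => 1).tsum_eq
  simpa using h

include hprob h1 hs hlam

theorem summable_abs_diff : Summable fun k => |lawMass μ (W I n) k - bpApprox p n k| :=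
  Summable.of_nonneg_of_le (fun _ => abs_nonneg _) (fun _ => abs_sub _ _)
    ((summable_abs_lawMass hI h01).add
      (summable_abs_bpApprox (fun i => hprob i ▸ measureReal_nonneg) h1 hs hlam))

theorem tsum_diff_eq {h : ℕ → ℝ} {H : ℝ} (hh : ∀ k, |h k| ≤ H) :
    ∑' k, lawMass μ (W I n) k * h k - ∑' k, bpApprox p n k * h k =
      ∑' k, (lawMass μ (W I n) k - bpApprox p n k) * h k := by
  rw [← Summable.tsum_sub (summable_mul_of_bounded (summable_abs_lawMass hI h01) hh)
    (summable_mul_of_bounded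
      (summable_abs_bpApprox (fun i => hprob i ▸ measureReal_nonneg) h1 hs hlam) hh)]
  exact tsum_congr fun k => by ring

include hWt

/-- The comparison of `W` with `Po(λ) * BP` through a solution of the Poisson Stein equation. -/
theorem abs_tsum_diff_le {f u : ℕ → ℝ} {F C L c : ℝ} (hf : ∀ k, |f k| ≤ F)
    (hu : ∀ k, |u k| ≤ C) (hd : ∀ k, |fwd u k| ≤ L) (hu0 : lam p n * u 0 = f 0 - c)
    (husucc : ∀ j : ℕ, lam p n * u (j + 1) - ((j : ℝ) + 1) * u j = f (j + 1) - c) :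
    |∑' k, (lawMass μ (W I n) k - bpApprox p n k) * f k| ≤
      L * eta μ p I Wt n + |∑' k, lawMass μ (W I n) k * pert (fun i => p (n + i)) u k| +
      |∑' k, (lawMass μ (W I n) k - bpApprox p n k) * pert p u k| := by
  have h0 : ∀ i, 0 ≤ p i := fun i => hprob i ▸ measureReal_nonneg
  have hpb := summable_abs_bpApprox h0 h1 hs hlam
  have hpert := abs_pert_le h0 h1 hs hu hd
  -- Both Stein equations in one formula; at `k = 0` the truncated `k - 1` is harmless.
  have hfk : ∀ k : ℕ, f k = c + lam p n * u k - k * u (k - 1) := by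
    intro k
    rcases k with _ | k
    · simp only [Nat.cast_zero, zero_mul]
      linarith
    · have := husucc k
      rw [Nat.add_sub_cancel]
      push_cast
      linarith
  have hWm := (measurable_W (n := n) hI).aemeasurable (μ := μ)
  have hint := integrable_comp_of_ae_le hWm (ae_W_le h01)
  have hlaw : ∑' k, lawMass μ (W I n) k * f k =
      c + ∫ ω, lam p n * u (W I n ω) ∂μ - ∫ ω, (W I n ω : ℝ) * u (W I n ω - 1) ∂μ := by
    rw [(hasSum_lawMass_mul hI h01 f).tsum_eq]
    simp only [hfk]
    rw [integral_sub (hint fun k => c + lam p n * u k) (hint fun k => k * u (k - 1)),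
      integral_add (integrable_const c) (hint fun k => lam p n * u k), integral_const,
      probReal_univ, one_smul]
  have hsb : ∀ {h : ℕ → ℝ} {H : ℝ}, (∀ k, |h k| ≤ H) →
      Summable fun k => bpApprox p n k * h k := fun hh => summable_mul_of_bounded hpb hh
  have hst : HasSum (fun k : ℕ => bpApprox p n k * (k * u (k - 1)))
      (∑' k, bpApprox p n k * (lam p n * u k) + ∑' k, bpApprox p n k * pert p u k) := by
    have h := stein_identity h0 h1 hs hlam.le hu
    have hul : ∀ k, |lam p n * u k| ≤ lam p n * C := fun k => by
      rw [abs_mul, abs_of_pos hlam]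
      exact mul_le_mul_of_nonneg_left (hu k) hlam.le
    rw [← Summable.tsum_add (hsb hul) (hsb hpert), ← hasSum_nat_add_iff' 1]
    simp only [Finset.sum_range_one, Nat.cast_zero, zero_mul, mul_zero, sub_zero]
    convert! h using 1
    · funext k
      rw [Nat.add_sub_cancel, bpApprox]
      push_cast
      ring
    · exact tsum_congr fun k => by rw [bpApprox]; ring
  -- The total mass is 1 and the Stein identity cancels the `λ u` term, leaving only the
  -- perturbation.
  have hbp : ∑' k, bpApprox p n k * f k = c - ∑' k, bpApprox p n k * pert p u k := by
    have hul : ∀ k, |lam p n * u k| ≤ lam p n * C := fun k => by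
      rw [abs_mul, abs_of_pos hlam]
      exact mul_le_mul_of_nonneg_left (hu k) hlam.le
    have hone : ∑' k, bpApprox p n k = 1 := tsum_conv_eq_one h0 h1 hs hlam.le
    have h2 := ((hpb.of_abs.hasSum.mul_right c).add (hsb hul).hasSum).sub hst
    rw [hone] at h2
    have h3 : HasSum (fun k => bpApprox p n k * f k) (c - ∑' k, bpApprox p n k * pert p u k) := by
      convert! h2 using 1
      · funext k
        rw [hfk k]
        ring
      · ring
    exact h3.tsum_eq
  have hE := abs_stein_expectation_le hI h01 hprob hWt h1 hs hu hd
  rw [integral_add (hint fun k => lam p n * u k) (hint fun k => pert p u k),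
    ← (hasSum_lawMass_mul hI h01 fun k => pert p u k).tsum_eq,
    ← (hasSum_lawMass_mul hI h01 fun k => pert (fun i => p (n + i)) u k).tsum_eq] at hE
  rw [← tsum_diff_eq hI h01 hprob h1 hs hlam hf, ← tsum_diff_eq hI h01 hprob h1 hs hlam hpert,
    hlaw, hbp]
  have a1 := neg_abs_le (∑' k, lawMass μ (W I n) k * pert (fun i => p (n + i)) u k)
  have a2 := le_abs_self (∑' k, lawMass μ (W I n) k * pert (fun i => p (n + i)) u k)
  have a3 := neg_abs_le (∑' k, lawMass μ (W I n) k * pert p u k - ∑' k, bpApprox p n k * pert p u k)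
  have a4 := le_abs_self (∑' k, lawMass μ (W I n) k * pert p u k -
    ∑' k, bpApprox p n k * pert p u k)
  rw [abs_le] at hE ⊢
  constructor <;> linarith [hE.1, hE.2]

theorem abs_tsum_diff_le_of_fwd {f u : ℕ → ℝ} {F C L c : ℝ} (hf : ∀ k, |f k| ≤ F)
    (hu : ∀ k, |u k| ≤ C) (hd : ∀ k, |fwd u k| ≤ L) (hu0 : lam p n * u 0 = f 0 - c)
    (husucc : ∀ j : ℕ, lam p n * u (j + 1) - ((j : ℝ) + 1) * u j = f (j + 1) - c) :
    |∑' k, (lawMass μ (W I n) k - bpApprox p n k) * f k| ≤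
      L * (tailSum p n + eta μ p I Wt n) +
      (∑' k, |lawMass μ (W I n) k - bpApprox p n k|) * (lam p n * theta p n * L) := by
  have h0 : ∀ i, 0 ≤ p i := fun i => hprob i ▸ measureReal_nonneg
  have hs' : Summable fun i => p (n + i) ^ 2 := by
    simpa only [add_comm n] using (summable_nat_add_iff n).mpr hs
  have hmain := abs_tsum_diff_le hI h01 hprob hWt h1 hs hlam hf hu hd hu0 husucc
  have ht := abs_tsum_mul_le (summable_abs_lawMass (n := n) hI h01)
    (abs_pert_le (p := fun i => p (n + i)) (fun i => h0 _) (fun i => h1 _) hs' hu hd)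
  have hl : ∑' k, |lawMass μ (W I n) k| = 1 := by
    rw [← tsum_lawMass (μ := μ) (n := n) hI h01]
    exact tsum_congr fun k => abs_of_nonneg measureReal_nonneg
  rw [hl, one_mul] at ht
  have hD := abs_tsum_mul_le (summable_abs_diff hI h01 hprob h1 hs hlam)
    (abs_pert_le h0 h1 hs hu hd)
  rw [tsum_weight_eq hlam] at hD
  rw [tailSum]
  linarith

variable (hθ : theta p n < 1 / 2)
include hθ

theorem tsum_abs_diff_le : ∑' k, |lawMass μ (W I n) k - bpApprox p n k| ≤
    2 / (lam p n * (1 - 2 * theta p n)) * (tailSum p n + eta μ p I Wt n) := by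
  set D := fun k => lawMass μ (W I n) k - bpApprox p n k with hD
  have hsum : Summable fun k => |D k| := summable_abs_diff hI h01 hprob h1 hs hlam
  have key : ∀ N, ∑ k ∈ Finset.range N, |D k| ≤
      2 / lam p n * (tailSum p n + eta μ p I Wt n) +
      (∑' k, |D k|) * (lam p n * theta p n * (2 / lam p n)) := by
    intro N
    -- The optimal test function, cut off at `N` so that its Stein solution is a finite sum.
    set f : ℕ → ℝ := fun k => if k < N then (SignType.sign (D k) : ℝ) else 0 with hfdef
    have hN : ∀ k, N ≤ k → f k = 0 := fun k hk => if_neg (not_lt.mpr hk)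
    have hf : ∀ k, |f k| ≤ 1 := fun k => by
      simp only [hfdef]
      split_ifs
      · rcases SignType.sign (D k) with _ | _ | _ <;> simp
      · simp
    obtain ⟨C, hC⟩ := exists_abs_steinSol_le hlam N f
    have h := abs_tsum_diff_le_of_fwd hI h01 hprob hWt h1 hs hlam hf hC
      (abs_fwd_steinSol_le hlam N hf) (steinSol_zero hlam hN) (steinSol_succ hlam hN)
    have e : ∑' k, D k * f k = ∑ k ∈ Finset.range N, |D k| := by
      rw [tsum_eq_sum (s := Finset.range N)]
      · refine Finset.sum_congr rfl fun k hk => ?_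
        simp only [hfdef, if_pos (Finset.mem_range.mp hk)]
        exact self_mul_sign _
      · intro k hk
        rw [hN k (by simpa using hk), mul_zero]
    rw [← e]
    exact (le_abs_self _).trans h
  -- The distance, finite by `hsum`, now appears on both sides, on the right with coefficient `2θ <
  -- 1`; it is solved for.
  have hle := Real.tsum_le_of_sum_range_le (fun _ => abs_nonneg _) key
  have hpos : 0 < 1 - 2 * theta p n := by linarith
  have e1 : lam p n * theta p n * (2 / lam p n) = 2 * theta p n := by
    have := hlam.ne'
    field_simp
  rw [e1] at hle
  have e2 : 2 / (lam p n * (1 - 2 * theta p n)) * (tailSum p n + eta μ p I Wt n) =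
      (2 / lam p n * (tailSum p n + eta μ p I Wt n)) / (1 - 2 * theta p n) := by
    have := hlam.ne'
    field_simp
  rw [e2, le_div_iff₀ hpos]
  linarith

/-- The absorption argument with `δ = sup |D|`: the perturbation of a point solution is in `ℓ¹`, so
it pairs with `δ`, or with the largest mass of `W` in the tail term. -/
theorem abs_diff_le (k : ℕ) : |lawMass μ (W I n) k - bpApprox p n k| ≤
    2 / (lam p n * (1 - 2 * theta p n)) *
      ((⨆ k, lawMass μ (W I n) k) * tailSum p n + eta μ p I Wt n) := by
  have h0 : ∀ i, 0 ≤ p i := fun i => hprob i ▸ measureReal_nonneg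
  have hs' : Summable fun i => p (n + i) ^ 2 := by
    simpa only [add_comm n] using (summable_nat_add_iff n).mpr hs
  set D := fun k => lawMass μ (W I n) k - bpApprox p n k with hD
  have hsum : Summable fun k => |D k| := summable_abs_diff hI h01 hprob h1 hs hlam
  have hbdd : BddAbove (Set.range fun k => |D k|) := by
    refine ⟨∑' k, |D k|, ?_⟩
    rintro _ ⟨k, rfl⟩
    exact hsum.le_tsum k fun _ _ => abs_nonneg _
  have hbddP : BddAbove (Set.range fun k => lawMass μ (W I n) k) := by
    refine ⟨1, ?_⟩
    rintro _ ⟨k, rfl⟩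
    exact measureReal_le_one
  set δ := ⨆ k, |D k| with hδ
  have hδle : ∀ k, |D k| ≤ δ := fun k => le_ciSup hbdd k
  have hPle : ∀ k, |lawMass μ (W I n) k| ≤ ⨆ k, lawMass μ (W I n) k := fun k => by
    rw [abs_of_nonneg (show 0 ≤ lawMass μ (W I n) k from measureReal_nonneg)]
    exact le_ciSup hbddP k
  set P := ⨆ k, lawMass μ (W I n) k with hP
  have hlam' := hlam.ne'
  have key : ∀ k, |D k| ≤ 2 / lam p n * (P * tailSum p n + eta μ p I Wt n) +
      2 * theta p n * δ := by
    intro k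
    set f : ℕ → ℝ := fun j => if j = k then 1 else 0 with hfdef
    have hN : ∀ j, k + 1 ≤ j → f j = 0 := fun j hj => if_neg (by omega)
    have hf : ∀ j, |f j| ≤ 1 := fun j => by
      simp only [hfdef]
      split_ifs <;> simp
    have hsol : steinSol (lam p n) (k + 1) f = steinPoint (lam p n) k := by
      funext j
      simp [steinSol, hfdef]
    obtain ⟨C, hC⟩ := exists_abs_steinSol_le hlam (k + 1) f
    have hS : ∀ N, ∑ j ∈ Finset.range N, |fwd (steinSol (lam p n) (k + 1) f) j| ≤
        2 / lam p n := fun N => by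
      rw [hsol]
      exact sum_abs_steinPoint_diff_le hlam k N
    have h := abs_tsum_diff_le hI h01 hprob hWt h1 hs hlam hf hC
      (abs_fwd_steinSol_le hlam (k + 1) hf) (steinSol_zero hlam hN) (steinSol_succ hlam hN)
    have ht := abs_tsum_mul_le_of_sum_le hPle
      (sum_abs_pert_le (p := fun i => p (n + i)) (fun i => h0 _) (fun i => h1 _) hs' hC hS)
    have hd := abs_tsum_mul_le_of_sum_le hδle (sum_abs_pert_le h0 h1 hs hC hS)
    rw [tsum_weight_eq hlam] at hd
    have e : ∑' j, D j * f j = D k := by simp [hfdef]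
    rw [e] at h
    have e1 : δ * (lam p n * theta p n * (2 / lam p n)) = 2 * theta p n * δ := by field_simp
    rw [e1] at hd
    have e2 : ∑' i, p (n + i) ^ 2 / (1 - 2 * p (n + i)) ^ 2 = tailSum p n := rfl
    rw [e2] at ht
    have e3 : P * (tailSum p n * (2 / lam p n)) = 2 / lam p n * (P * tailSum p n) := by ring
    rw [e3] at ht
    linarith
  have hle : δ ≤ _ := ciSup_le key
  have hpos : 0 < 1 - 2 * theta p n := by linarith
  have e2 : 2 / (lam p n * (1 - 2 * theta p n)) * (P * tailSum p n + eta μ p I Wt n) =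
      (2 / lam p n * (P * tailSum p n + eta μ p I Wt n)) / (1 - 2 * theta p n) := by
    field_simp
  rw [e2]
  refine (hδle k).trans ?_
  rw [le_div_iff₀ hpos]
  linarith

/-- Here the perturbation is bounded, so the total variation estimate controls the last term. The
constants combine by `1 + 2θ / (1 - 2θ) = 1 / (1 - 2θ)`. -/
theorem abs_tsum_diff_le_of_lipschitz_of_support {N : ℕ} {f : ℕ → ℝ}
    (hN : ∀ k, N ≤ k → f k = 0) (hf : ∀ k, |f (k + 1) - f k| ≤ 1) :
    |∑' k, (lawMass μ (W I n) k - bpApprox p n k) * f k| ≤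
      1.15 / (Real.sqrt (lam p n) * (1 - 2 * theta p n)) * (tailSum p n + eta μ p I Wt n) := by
  obtain ⟨C, hC⟩ := exists_abs_steinSol_le hlam N f
  have hfb : ∀ k, |f k| ≤ ∑ j ∈ Finset.range N, |f j| := fun k => by
    rcases lt_or_ge k N with hk | hk
    · exact Finset.single_le_sum (f := fun k => |f k|) (fun _ _ => abs_nonneg _)
        (Finset.mem_range.mpr hk)
    · rw [hN k hk, abs_zero]
      exact Finset.sum_nonneg fun _ _ => abs_nonneg _
  have h := abs_tsum_diff_le_of_fwd hI h01 hprob hWt h1 hs hlam hfb hC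
    (abs_stein_diff_le_of_lipschitz hlam hN hf (steinSol_zero hlam hN) (steinSol_succ hlam hN))
    (steinSol_zero hlam hN) (steinSol_succ hlam hN)
  have hτ := tsum_abs_diff_le hI h01 hprob hWt h1 hs hlam hθ
  have hθ0 := theta_nonneg hlam
  have hsq := Real.sqrt_pos.mpr hlam
  have hpos : 0 < 1 - 2 * theta p n := by linarith
  have hc : 0 ≤ lam p n * theta p n * (1.15 / Real.sqrt (lam p n)) := by positivity
  refine (h.trans (add_le_add_right (mul_le_mul_of_nonneg_right hτ hc) _)).trans_eq ?_
  have := hlam.ne'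
  have := hpos.ne'
  have := hsq.ne'
  field_simp
  ring

/-- Apply the finitely supported case to `f (min k N) - f N`, which is still Lipschitz. Subtracting
the constant costs nothing since the difference has total mass 0, and finite first moments give the
limit `N → ∞`. -/
theorem abs_tsum_sub_tsum_le_of_lipschitz {f : ℕ → ℝ} (hf : ∀ k, |f (k + 1) - f k| ≤ 1) :
    |∑' k, lawMass μ (W I n) k * f k - ∑' k, bpApprox p n k * f k| ≤
      1.15 / (Real.sqrt (lam p n) * (1 - 2 * theta p n)) * (tailSum p n + eta μ p I Wt n) := by
  have h0 : ∀ i, 0 ≤ p i := fun i => hprob i ▸ measureReal_nonneg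
  have hpb := summable_abs_bpApprox h0 h1 hs hlam
  have hlb := summable_abs_lawMass (n := n) hI h01
  have hpm : Summable fun k : ℕ => (k : ℝ) * |bpApprox p n k| :=
    summable_mul_abs_conv h0 h1 hs hlam.le
  have hlm := summable_nat_mul_lawMass (n := n) hI h01
  have hgrow : ∀ k : ℕ, |f k| ≤ |f 0| + k := fun k => by
    have h := abs_sub_le_mul_of_fwd (v := f) hf k 0
    have h2 := abs_sub_abs_le_abs_sub (f k) (f 0)
    simp only [Nat.cast_zero, sub_zero, Nat.abs_cast, one_mul] at h
    linarith
  have hbound : ∀ a : ℕ → ℝ, (Summable fun k => |a k|) → (Summable fun k : ℕ => (k : ℝ) * |a k|) →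
      Summable fun k : ℕ => |a k| * (|f 0| + k) := fun a ha hm =>
    ((ha.mul_right |f 0|).add hm).congr fun k => by ring
  have hsf : ∀ a : ℕ → ℝ, (Summable fun k => |a k|) → (Summable fun k : ℕ => (k : ℝ) * |a k|) →
      Summable fun k => a k * f k := fun a ha hm =>
    Summable.of_norm_bounded (hbound a ha hm) fun k => by
      rw [norm_mul]
      exact mul_le_mul_of_nonneg_left (hgrow k) (abs_nonneg _)
  set D := fun k => lawMass μ (W I n) k - bpApprox p n k with hD
  have hDs : Summable fun k => |D k| := summable_abs_diff hI h01 hprob h1 hs hlam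
  have hDm : Summable fun k : ℕ => (k : ℝ) * |D k| := by
    refine Summable.of_nonneg_of_le (fun _ => by positivity) (fun k => ?_) (hlm.add hpm)
    rw [← mul_add]
    exact mul_le_mul_of_nonneg_left (abs_sub _ _) k.cast_nonneg
  have e : ∑' k, lawMass μ (W I n) k * f k - ∑' k, bpApprox p n k * f k = ∑' k, D k * f k := by
    rw [← Summable.tsum_sub (hsf _ hlb hlm) (hsf _ hpb hpm)]
    exact tsum_congr fun k => by simp only [hD]; ring
  have hD0 : ∑' k, D k = 0 := by
    have hone : ∑' k, bpApprox p n k = 1 := tsum_conv_eq_one h0 h1 hs hlam.le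
    rw [Summable.tsum_sub hlb.of_abs hpb.of_abs, tsum_lawMass hI h01, hone, sub_self]
  have hlim : Filter.Tendsto (fun N => ∑' k, D k * f (min k N)) Filter.atTop
      (nhds (∑' k, D k * f k)) := by
    refine tendsto_tsum_of_dominated_convergence (hbound D hDs hDm) (fun k => ?_)
      (Filter.Eventually.of_forall fun N k => ?_)
    · refine tendsto_const_nhds.congr' ?_
      filter_upwards [Filter.eventually_ge_atTop k] with N hN
      rw [min_eq_left hN]
    · rw [norm_mul]
      refine mul_le_mul_of_nonneg_left ((hgrow _).trans ?_) (abs_nonneg _)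
      have : ((min k N : ℕ) : ℝ) ≤ k := by exact_mod_cast min_le_left k N
      linarith
  rw [e]
  refine le_of_tendsto hlim.abs (Filter.Eventually.of_forall fun N => ?_)
  have hlip : ∀ k, |(f (min (k + 1) N) - f N) - (f (min k N) - f N)| ≤ 1 := fun k => by
    rcases lt_or_ge k N with hk | hk
    · rw [min_eq_left hk, min_eq_left hk.le, sub_sub_sub_cancel_right]
      exact hf k
    · rw [min_eq_right hk, min_eq_right (by omega)]
      simp
  have h := abs_tsum_diff_le_of_lipschitz_of_support hI h01 hprob hWt h1 hs hlam hθ (N := N)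
    (f := fun k => f (min k N) - f N) (fun k hk => by rw [min_eq_right hk, sub_self]) hlip
  have e2 : ∑' k, D k * (f (min k N) - f N) = ∑' k, D k * f (min k N) := by
    have hsm : Summable fun k => D k * f (min k N) :=
      Summable.of_norm_bounded (hbound D hDs hDm) fun k => by
        rw [norm_mul]
        refine mul_le_mul_of_nonneg_left ((hgrow _).trans ?_) (abs_nonneg _)
        have : ((min k N : ℕ) : ℝ) ≤ k := by exact_mod_cast min_le_left k N
        linarith
    simp only [mul_sub]
    rw [Summable.tsum_sub hsm (hDs.of_abs.mul_right _), tsum_mul_right, hD0, zero_mul, sub_zero]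
  rw [← e2]
  exact h

end

end BorovkovPfeifer

open BorovkovPfeifer

theorem theorem4p1 {Ω : Type*} [MeasurableSpace Ω] (μ : MeasureTheory.Measure Ω)
    [MeasureTheory.IsProbabilityMeasure μ] (n : ℕ) (p : ℕ → ℝ) (I Wt : ℕ → Ω → ℕ)
    -- the variables `I i` are Bernoulli with parameter `p i`, with any joint law
    (hI_meas : ∀ i, Measurable (I i))
    (hI_val : ∀ i, ∀ᵐ ω ∂μ, I i ω = 0 ∨ I i ω = 1)
    (hI_prob : ∀ i, μ.real {ω | I i ω = 1} = p i)
    -- `Wt i` has the conditional law of `W - I i` given `I i = 1`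
    (hWt : ∀ i < n, 0 < p i →
      ProbabilityTheory.IdentDistrib (Wt i) (BorovkovPfeifer.Wminus I n i) μ
        (ProbabilityTheory.cond μ {ω | I i ω = 1}))
    (hp : ∀ i, p i < 1 / 3)
    (hp_sq : Summable (fun i => p i ^ 2))
    (hlam : 0 < BorovkovPfeifer.lam p n)
    (hθ : BorovkovPfeifer.theta p n < 1 / 2) :
    -- `BP` is a finite signed measure with the prescribed generating function
    (Summable (fun k => |BorovkovPfeifer.bp p k|) ∧
      ∀ z : ℂ, ‖z‖ ≤ 1 →
        Multipliable (BorovkovPfeifer.bpFactor p z) ∧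
        HasSum (fun k => (BorovkovPfeifer.bp p k : ℂ) * z ^ k)
          (BorovkovPfeifer.bpGenFun p z)) ∧
    -- `Po(λ) * BP` is signed compound Poisson and has a finite first absolute moment
    BorovkovPfeifer.IsSignedCompoundPoisson (BorovkovPfeifer.bpApprox p n) ∧
    Summable (fun k : ℕ => (k : ℝ) * |BorovkovPfeifer.bpApprox p n k|) ∧
    -- the three bounds
    BorovkovPfeifer.distTV (BorovkovPfeifer.lawMass μ (BorovkovPfeifer.W I n))
        (BorovkovPfeifer.bpApprox p n) ≤
      ENNReal.ofReal
        (2 / (BorovkovPfeifer.lam p n * (1 - 2 * BorovkovPfeifer.theta p n)) *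
          (BorovkovPfeifer.tailSum p n + BorovkovPfeifer.eta μ p I Wt n)) ∧
    BorovkovPfeifer.distPt (BorovkovPfeifer.lawMass μ (BorovkovPfeifer.W I n))
        (BorovkovPfeifer.bpApprox p n) ≤
      ENNReal.ofReal
        (2 / (BorovkovPfeifer.lam p n * (1 - 2 * BorovkovPfeifer.theta p n)) *
          ((⨆ k, BorovkovPfeifer.lawMass μ (BorovkovPfeifer.W I n) k) *
              BorovkovPfeifer.tailSum p n +
            BorovkovPfeifer.eta μ p I Wt n)) ∧
    BorovkovPfeifer.distW (BorovkovPfeifer.lawMass μ (BorovkovPfeifer.W I n))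
        (BorovkovPfeifer.bpApprox p n) ≤
      ENNReal.ofReal
        (1.15 / (Real.sqrt (BorovkovPfeifer.lam p n) *
            (1 - 2 * BorovkovPfeifer.theta p n)) *
          (BorovkovPfeifer.tailSum p n + BorovkovPfeifer.eta μ p I Wt n)) := by
  have h0 : ∀ i, 0 ≤ p i := fun i => hI_prob i ▸ measureReal_nonneg
  have hbp := bp_eq_coeff h0 hp hp_sq
  refine ⟨⟨?_, fun z hz => ⟨(hasProd_bpFactor h0 hp hp_sq hz).multipliable, ?_⟩⟩,
    isSignedCompoundPoisson_conv h0 hp hp_sq hlam.le,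
    summable_mul_abs_conv h0 hp hp_sq hlam.le, ?_, ?_, ?_⟩
  · simp only [hbp]
    exact (absSummable_logSeries (summable_abs_bpCoeff h0 hp hp_sq)).expSeries
  · simp only [hbp]
    exact hasSum_bpGenFun h0 hp hp_sq hz
  · refine iSup₂_le fun f hf => ENNReal.ofReal_le_ofReal ?_
    rw [tsum_diff_eq hI_meas hI_val hI_prob hp hp_sq hlam hf]
    refine (abs_tsum_mul_le (summable_abs_diff hI_meas hI_val hI_prob hp hp_sq hlam) hf).trans ?_
    rw [mul_one]
    exact tsum_abs_diff_le hI_meas hI_val hI_prob hWt hp hp_sq hlam hθ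
  · exact iSup_le fun k => ENNReal.ofReal_le_ofReal
      (abs_diff_le hI_meas hI_val hI_prob hWt hp hp_sq hlam hθ k)
  · exact iSup₂_le fun f hf => ENNReal.ofReal_le_ofReal
      (abs_tsum_sub_tsum_le_of_lipschitz hI_meas hI_val hI_prob hWt hp hp_sq hlam hθ hf)
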